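/- Fix a prime number $p$, and let $G$ be a group of inertia type, i.e. a finite group having a normal $p$-subgroup $H$ such that $G/H$ is cyclic of order prime to $p$. Let $\ell\neq p$ be a prime number. Let $K$ be a complete discrete valuation field of characteristic $0$ and residue characteristic $\ell$, with valuation ring $\mathcal{O}_K$ and valuation $v$ normalized so that $v(K^\times)=\mathbf{Z}$, and let $e=v(\ell)$ be its absolute ramification degree. Let $V$ be a $K$-vector space of dimension $2d$ with a $K$-linear action of $G$, and suppose that $V$ is a symplectic $K[G]$-module, i.e. that there is a nondegenerate alternating $G$-invariant $K$-bilinear form $V\times V\to K$. Suppose that $\ell>de+1$. Then there exist a $G$-stable $\mathcal{O}_K$-lattice $T$ in $V$ (a finitely generated $\mathcal{O}_K$-submodule spanning $V$ over $K$) and a perfect alternating $G$-invariant $\mathcal{O}_K$-bilinear form $$f' : T\times T\to\mathcal{O}_K,$$ where perfect means that both natural maps $T\to\mathrm{Hom}_{\mathcal{O}_K}(T,\mathcal{O}_K)$ are bijective. In matrix terms: for every $K$-basis of $V$, the image of $G$ in $\mathrm{GL}_{2d}(K)$ is conjugate in $\mathrm{GL}_{2d}(K)$ to a subgroup of $\mathrm{Sp}_{2d}(\mathcal{O}_K)$.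 -/

import Mathlib

/-- `G` is a group of inertia type with respect to the prime `p`: it is finite and has a normal
`p`-subgroup `H` such that `G ⧸ H` is cyclic of order prime to `p`. -/
def IsOfInertiaType (p : ℕ) (G : Type*) [Group G] : Prop :=
  Finite G ∧ ∃ (H : Subgroup G) (_ : H.Normal),
    IsPGroup p H ∧ IsCyclic (G ⧸ H) ∧ (Nat.card (G ⧸ H)).Coprime p

/-- `V` (with the action `ρ`) is a symplectic `K[G]`-module: it carries a nondegenerate alternating
`G`-invariant `K`-bilinear form. -/
def Representation.IsSymplectic {K G V : Type*} [Field K] [Group G] [AddCommGroup V] [Module K V]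
    (ρ : Representation K G V) : Prop :=
  ∃ f : LinearMap.BilinForm K V, f.Nondegenerate ∧ f.IsAlt ∧
    ∀ (g : G) (x y : V), f (ρ g x) (ρ g y) = f x y

/-!
Decomposing `V` into orthogonal summands and dividing `G` by the kernel of the action, one may
assume that `V` is symplectically indecomposable and that `G` acts faithfully. Choose an invariant
symplectic form and a stable integral lattice `T` with dual `L` so that the length of `L / T` is as
small as possible. Then the maximal ideal kills `L / T`, whose length is at most `d`.

If `ℓ` does not divide the order of `G`, averaging gives an equivariant `p` that projects `L` onto
`T` modulo the uniformizer `π`, and with `q = 1 - p` the lattice `L` is self-dual for the form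
`f (p x) (p y) + π f (q x) (q y)`.

Otherwise suppose that `T ≠ L`. An automorphism of `ℓ`-power order of a minimal linear group of
prime-to-`ℓ` order on which it acts nontrivially would force an irreducible representation of
dimension `r > 1` with `r² ≡ 1` modulo `ℓ`. Since the length of `L / T` is less than `ℓ - 1`, the
elements of order `ℓ` therefore commute with `H` on `L / T`, and by indecomposability they commute
with `H` in `G`. As `G / H` is cyclic, `G` has a central element `τ` of order `ℓ`. By
indecomposability `τ - 1` is injective on `V`, and it maps `L` into `T`, so that `ℓ - 1` times the
length of `L / T` is at most `2 d e`, because `(τ - 1) ^ (ℓ - 1)` equals `ℓ` up to a unit. But the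
length of `L / T` is at least `2`, on account of its perfect alternating form, which contradicts
`d e + 1 < ℓ`.
-/

open Module
open scoped commutatorElement

section CoprimeAction

variable {P : Type*} [Group P] {φ : P →* P} {a : ℕ}

theorem eq_one_of_map_eq_mul {x z : P} {b : ℕ} (hab : a.Coprime b) (hφ : φ^[a] = id)
    (hz : z ^ b = 1) (hφz : φ z = z) (hx : φ x = x * z) : z = 1 := by
  have iterate_eq (k : ℕ) : φ^[k] x = x * z ^ k := by
    induction k with
    | zero => simp
    | succ k ih => rw [Function.iterate_succ_apply', ih, map_mul, map_pow, hφz, hx, mul_assoc,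
        pow_succ']
  have hza : z ^ a = 1 := by simpa [hφ] using (iterate_eq a).symm
  simpa [hab.gcd_eq_one] using pow_gcd_eq_one.2 ⟨hza, hz⟩

theorem map_eq_self_of_inv_mul_mem (hcop : a.Coprime (Nat.card P)) (hφ : φ^[a] = id)
    {x : P} (hx : φ (x⁻¹ * φ x) = x⁻¹ * φ x) : φ x = x := by
  have hz : x⁻¹ * φ x = 1 :=
    eq_one_of_map_eq_mul hcop hφ pow_card_eq_one' hx (mul_inv_cancel_left x (φ x)).symm
  exact (inv_mul_eq_one.1 hz).symm

theorem le_center_of_le_eqLocus (hcop : a.Coprime (Nat.card P)) (hφ : φ^[a] = id)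
    (hne : φ ≠ MonoidHom.id P)
    (hfix : ∀ Q : Subgroup P, Q < ⊤ → Q ≤ Q.comap φ → Q ≤ φ.eqLocus (.id P))
    {Q : Subgroup P} [hQn : Q.Normal] (hQ : Q ≤ φ.eqLocus (.id P)) :
    Q ≤ Subgroup.center P := by
  have hφQ {q : P} (hq : q ∈ Q) : φ q = q := hQ hq
  let D := Subgroup.centralizer (Q : Set P)
  have hD_invariant : D ≤ D.comap φ := by
    intro x hx q hq
    rw [← hφQ hq, ← map_mul, ← map_mul, hx q hq]
  suffices D = ⊤ from Subgroup.centralizer_eq_top_iff_subset.1 this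
  by_contra hD
  refine hne (MonoidHom.ext fun x => map_eq_self_of_inv_mul_mem hcop hφ
    (hfix D (lt_top_iff_ne_top.2 hD) hD_invariant fun q hq => ?_))
  have hconj : φ x * q = x * q * x⁻¹ * φ x := by
    rw [← mul_inv_eq_iff_eq_mul]
    simpa [hφQ hq] using hφQ (hQn.conj_mem q hq x)
  rw [mul_assoc x⁻¹, hconj]
  group

theorem commutator_le_eqLocus [Group.IsSolvable P] [Nontrivial P]
    (hfix : ∀ Q : Subgroup P, Q < ⊤ → Q ≤ Q.comap φ → Q ≤ φ.eqLocus (.id P)) :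
    commutator P ≤ φ.eqLocus (.id P) :=
  hfix _ (Group.IsSolvable.commutator_lt_top_of_nontrivial P) <|
    Subgroup.map_le_iff_le_comap.1 <| by
      rw [commutator_def, Subgroup.map_commutator]
      exact Subgroup.commutator_mono le_top le_top

theorem index_eqLocus_modEq_one {ℓ s : ℕ} [Fact ℓ.Prime] [Finite P]
    (hcop : (ℓ ^ s).Coprime (Nat.card P)) (hφ : φ^[ℓ ^ s] = id) :
    (φ.eqLocus (.id P)).index ≡ 1 [MOD ℓ] := by
  classical
  let C := φ.eqLocus (.id P)
  let f : Function.End (P ⧸ C) :=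
    Quotient.map' φ fun x y hxy => by
      rw [QuotientGroup.leftRel_apply] at hxy ⊢
      rw [← map_inv, ← map_mul]
      exact congrArg φ hxy
  have semiconj : Function.Semiconj (QuotientGroup.mk : P → P ⧸ C) φ f := fun _ => rfl
  have f_pow : f ^ ℓ ^ s = 1 := by
    have pow_eq_iterate : f ^ ℓ ^ s = f^[ℓ ^ s] :=
      hom_coe_pow (fun g : Function.End _ => g) rfl (fun _ _ => rfl) f _
    rw [pow_eq_iterate]
    funext q
    obtain ⟨x, rfl⟩ := QuotientGroup.mk_surjective q
    rw [← (semiconj.iterate_right _).eq, hφ]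
    rfl
  have fixedPoints_eq : Function.fixedPoints f = {((1 : P) : P ⧸ C)} := by
    ext q
    obtain ⟨x, rfl⟩ := QuotientGroup.mk_surjective q
    refine ⟨fun hq => ?_, fun hq => ?_⟩
    · have hx : x ∈ C := map_eq_self_of_inv_mul_mem hcop hφ (QuotientGroup.eq.1 hq.symm)
      exact QuotientGroup.eq.2 (by simpa using hx)
    · rw [hq]
      exact congrArg QuotientGroup.mk (map_one φ)
  have := Fintype.ofFinite (P ⧸ C)
  have hmod := Equiv.Perm.card_fixedPoints_modEq f_pow
  simpa [fixedPoints_eq, ← Nat.card_eq_fintype_card, ← Subgroup.index_eq_card] using hmod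

end CoprimeAction

section Character

open Representation

variable {E P W : Type*} [Field E] [IsAlgClosed E] [Group P] [AddCommGroup W] [Module E W]
  [FiniteDimensional E W] (σ : Representation E P W) [IsIrreducible σ]

theorem exists_eq_algebraMap_of_forall_commute {z : P} (hz : ∀ y, Commute (σ z) (σ y)) :
    ∃ c : E, σ z = algebraMap E (Module.End E W) c := by
  obtain ⟨c, hc⟩ := IsIrreducible.algebraMap_intertwiningMap_bijective_of_isAlgClosed.2
    (⟨σ z, fun y => (hz y).eq⟩ : IntertwiningMap σ σ)
  exact ⟨c, (congrArg IntertwiningMap.toLinearMap hc).symm⟩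

theorem exists_eq_algebraMap_of_mem_center {z : P} (hz : z ∈ Subgroup.center P) :
    ∃ c : E, σ z = algebraMap E (Module.End E W) c :=
  exists_eq_algebraMap_of_forall_commute σ fun y =>
    (show Commute z y from (Subgroup.mem_center_iff.1 hz y).symm).map σ

theorem character_eq_zero {x y : P} (hxy : ⁅x, y⁆ ∈ Subgroup.center P) (hσ : σ ⁅x, y⁆ ≠ 1) :
    σ.character x = 0 := by
  obtain ⟨c, hc⟩ := exists_eq_algebraMap_of_mem_center σ hxy
  have hc1 : c ≠ 1 := by
    rintro rfl
    exact hσ (by rw [hc, map_one])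
  have hx : σ.character x = c * σ.character x := by
    conv_lhs => rw [show x = ⁅x, y⁆ * (y * x * y⁻¹) by rw [commutatorElement_def]; group]
    rw [← char_conj σ x y]
    simp only [character, map_mul σ ⁅x, y⁆, hc, Algebra.algebraMap_eq_smul_one, smul_mul_assoc,
      one_mul, map_smul, smul_eq_mul]
  have : (c - 1) * σ.character x = 0 := by linear_combination -hx
  exact (mul_eq_zero.1 this).resolve_left (sub_ne_zero.2 hc1)

theorem character_mul_character_inv_of_mem_center {z : P} (hz : z ∈ Subgroup.center P) :
    σ.character z * σ.character z⁻¹ = (finrank E W : E) ^ 2 := by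
  obtain ⟨c, hc⟩ := exists_eq_algebraMap_of_mem_center σ hz
  obtain ⟨c', hc'⟩ := exists_eq_algebraMap_of_mem_center σ (inv_mem hz)
  have : Nontrivial W :=
    IsSimpleModule.nontrivial (MonoidAlgebra E P) σ.asModule
  have hcc' : c * c' = 1 := by
    refine (algebraMap E (Module.End E W)).injective ?_
    rw [map_mul, ← hc, ← hc', ← map_mul, mul_inv_cancel, map_one, map_one]
  simp only [character, hc, hc', Algebra.algebraMap_eq_smul_one, map_smul, LinearMap.trace_one,
    smul_eq_mul]
  linear_combination (finrank E W : E) ^ 2 * hcc'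

theorem finrank_sq_eq_index [Finite P] (hP : (Nat.card P : E) ≠ 0) {C : Subgroup P}
    (hC : C ≤ Subgroup.center P)
    (hmoved : ∀ x ∉ C, ∃ y, ⁅x, y⁆ ∈ Subgroup.center P ∧ σ ⁅x, y⁆ ≠ 1) :
    (finrank E W : E) ^ 2 = C.index := by
  classical
  have := Fintype.ofFinite P
  have := invertibleOfNonzero hP
  have sum_eq : ∑ x, σ.character x * σ.character x⁻¹ = Nat.card C * (finrank E W : E) ^ 2 := by
    calc ∑ x, σ.character x * σ.character x⁻¹
        = ∑ x with x ∈ C, σ.character x * σ.character x⁻¹ := by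
          refine (Finset.sum_filter_of_ne fun x _ hx => ?_).symm
          by_contra hxC
          obtain ⟨y, hy, hσy⟩ := hmoved x hxC
          rw [character_eq_zero σ hy hσy, zero_mul] at hx
          exact hx rfl
      _ = ∑ x with x ∈ C, (finrank E W : E) ^ 2 :=
          Finset.sum_congr rfl fun x hx =>
            character_mul_character_inv_of_mem_center σ (hC (Finset.mem_filter.1 hx).2)
      _ = Nat.card C * (finrank E W : E) ^ 2 := by
          rw [Finset.sum_const, nsmul_eq_mul, Nat.card_eq_fintype_card, Fintype.card_subtype]
  have horth := char_orthonormal σ σ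
  rw [if_pos ⟨Representation.Equiv.refl σ⟩, sum_eq, inv_mul_eq_one₀ hP, ← C.card_mul_index,
    Nat.cast_mul] at horth
  rw [← C.card_mul_index, Nat.cast_mul] at hP
  exact mul_left_cancel₀ (left_ne_zero_of_mul hP) horth.symm

end Character

theorem exists_isIrreducible_le {E P M : Type*} [Field E] [Group P] [AddCommGroup M] [Module E M]
    [FiniteDimensional E M] {θ : Representation E P M} {U : Subrepresentation θ} (hU : U ≠ ⊥) :
    ∃ W ≤ U, W.toRepresentation.IsIrreducible := by
  have : WellFoundedLT (Subrepresentation θ) :=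
    StrictMono.wellFoundedLT (f := Subrepresentation.toSubmodule) fun _ _ h => h
  have : IsAtomic (Subrepresentation θ) := isAtomic_of_orderBot_wellFounded_lt wellFounded_lt
  obtain ⟨W, hW, hWU⟩ := (eq_bot_or_exists_atom_le U).resolve_left hU
  have subrep_eq (T : Subrepresentation W.toRepresentation) : T = ⊥ ∨ T = ⊤ := by
    let T' : Subrepresentation θ :=
      ⟨T.toSubmodule.map W.toSubmodule.subtype, by
        rintro x _ ⟨w, hw, rfl⟩
        exact ⟨_, T.apply_mem_toSubmodule x hw, rfl⟩⟩
    have hT' : T'.toSubmodule ≤ W.toSubmodule := Submodule.map_subtype_le _ _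
    refine (hW.le_iff.1 (show T' ≤ W from hT')).imp (fun h => ?_) fun h => ?_ <;>
      refine Subrepresentation.toSubmodule_injective
        (Submodule.map_injective_of_injective W.toSubmodule.injective_subtype ?_)
    · exact (congrArg Subrepresentation.toSubmodule h).trans (Submodule.map_bot _).symm
    · exact (congrArg Subrepresentation.toSubmodule h).trans (Submodule.map_subtype_top _).symm
  have bot_ne_top : (⊥ : Subrepresentation W.toRepresentation) ≠ ⊤ := by
    intro h
    refine hW.1 (Subrepresentation.toSubmodule_injective ?_)
    rw [← Submodule.map_subtype_top W.toSubmodule]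
    exact (congrArg (fun T => T.toSubmodule.map W.toSubmodule.subtype) h.symm).trans
      (Submodule.map_bot _)
  exact ⟨W, hWU, { exists_pair_ne := ⟨⊥, ⊤, bot_ne_top⟩, eq_bot_or_eq_top := subrep_eq }⟩

theorem eq_id_of_iterate_prime_pow {α : Type*} [Finite α] {f : α → α} {p n : ℕ} (hp : p.Prime)
    (hcard : Nat.card α < p) (hf : f^[p ^ n] = id) : f = id := by
  have := Fintype.ofFinite α
  funext x
  have hdvd : Function.minimalPeriod f x ∣ p ^ n :=
    Function.IsPeriodicPt.minimalPeriod_dvd (congrFun hf x)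
  obtain ⟨k, -, hk⟩ := (Nat.dvd_prime_pow hp).1 hdvd
  have hlt : p ^ k < p ^ 1 := by
    rw [← hk, pow_one]
    exact (Function.minimalPeriod_le_card.trans_eq Fintype.card_eq_nat_card).trans_lt hcard
  rw [Nat.pow_lt_pow_iff_right hp.one_lt, Nat.lt_one_iff] at hlt
  exact Function.minimalPeriod_eq_one_iff_isFixedPt.1 (by rw [hk, hlt, pow_zero])

section Weights

variable {E P M : Type*} [Field E] [Group P] [AddCommGroup M] [Module E M]

/-- The simultaneous eigenspace of the operators `θ x` for the eigenvalues `χ x`. -/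
def weightSpace (θ : Representation E P M) (χ : P → E) : Submodule E M :=
  ⨅ x, Module.End.eigenspace (θ x) (χ x)

variable {θ : Representation E P M}

theorem mem_weightSpace {χ : P → E} {v : M} :
    v ∈ weightSpace θ χ ↔ ∀ x, θ x v = χ x • v := by
  simp [weightSpace]

theorem weightSpace_comp_ne_bot {φ : P →* P} {S : Module.End E M} (hS : Function.Injective S)
    (hSφ : ∀ x v, S (θ (φ x) v) = θ x (S v)) {χ : P → E} (hχ : weightSpace θ χ ≠ ⊥) :
    weightSpace θ (χ ∘ φ) ≠ ⊥ := by
  obtain ⟨v, hv, hv0⟩ := Submodule.exists_mem_ne_zero_of_ne_bot hχ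
  refine Submodule.ne_bot_iff _ |>.2 ⟨S v, mem_weightSpace.2 fun x => ?_, by simpa using hS.ne hv0⟩
  rw [← hSφ, mem_weightSpace.1 hv, map_smul, Function.comp_apply]

theorem weightSpace_eq_iInf_maxGenEigenspace (hP : (Nat.card P : E) ≠ 0) :
    weightSpace θ = fun χ => ⨅ x, Module.End.maxGenEigenspace (θ x) (χ x) := by
  funext χ
  refine iInf_congr fun x => (Module.End.IsFinitelySemisimple.maxGenEigenspace_eq_eigenspace
    (Module.End.IsSemisimple.isFinitelySemisimple ?_) (χ x)).symm
  refine Module.End.isSemisimple_of_squarefree_aeval_eq_zero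
    (p := Polynomial.X ^ Nat.card P - 1) (Polynomial.Separable.squarefree ?_) ?_
  · exact Polynomial.X_pow_sub_one_separable_iff.2 hP
  · rw [map_sub, map_pow, Polynomial.aeval_X, ← map_pow, pow_card_eq_one', map_one, map_one,
      sub_self]

theorem iSupIndep_weightSpace (hcomm : ∀ x y : P, Commute x y) (hP : (Nat.card P : E) ≠ 0) :
    iSupIndep (weightSpace θ) := by
  rw [weightSpace_eq_iInf_maxGenEigenspace hP]
  exact Module.End.independent_iInf_maxGenEigenspace_of_forall_mapsTo _
    fun x y c => Module.End.mapsTo_maxGenEigenspace_of_comm ((hcomm y x).map θ) c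

variable [FiniteDimensional E M] [IsAlgClosed E]

theorem iSup_weightSpace_eq_top (hcomm : ∀ x y : P, Commute x y) (hP : (Nat.card P : E) ≠ 0) :
    ⨆ χ, weightSpace θ χ = ⊤ := by
  rw [weightSpace_eq_iInf_maxGenEigenspace hP]
  exact Module.End.iSup_iInf_maxGenEigenspace_eq_top_of_iSup_maxGenEigenspace_eq_top_of_commute
    _ (fun x y _ => (hcomm x y).map θ) fun x => Module.End.iSup_maxGenEigenspace_eq_top _

theorem eq_id_of_commute_of_finrank_lt (hcomm : ∀ x y : P, Commute x y)
    (hP : (Nat.card P : E) ≠ 0) {ℓ s : ℕ} (hℓ : ℓ.Prime) (hdim : finrank E M < ℓ)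
    (hθ : Function.Injective θ) {φ : P →* P} (hφ : φ^[ℓ ^ s] = id) {S : Module.End E M}
    (hS : Function.Injective S) (hSφ : ∀ x v, S (θ (φ x) v) = θ x (S v)) :
    φ = MonoidHom.id P := by
  have independent := iSupIndep_weightSpace (θ := θ) hcomm hP
  let X := {χ : P → E // weightSpace θ χ ≠ ⊥}
  have : Fintype X := independent.fintypeNeBotOfFiniteDimensional
  have hcard : Nat.card X < ℓ := by
    rw [Nat.card_eq_fintype_card]
    exact independent.subtype_ne_bot_le_finrank.trans_lt hdim
  let F : X → X := fun χ => ⟨χ.1 ∘ φ, weightSpace_comp_ne_bot hS hSφ χ.2⟩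
  have iterate_F (k : ℕ) (χ : X) : (F^[k] χ).1 = χ.1 ∘ φ^[k] := by
    induction k generalizing χ with
    | zero => rfl
    | succ k ih =>
      rw [Function.iterate_succ_apply, ih, Function.iterate_succ', ← Function.comp_assoc]
  have F_eq : F = id := eq_id_of_iterate_prime_pow hℓ hcard <| by
    funext χ
    exact Subtype.ext (by rw [iterate_F, hφ]; rfl)
  refine MonoidHom.ext fun x => hθ (LinearMap.eqLocus_eq_top.1 (top_le_iff.1 ?_))
  rw [← iSup_weightSpace_eq_top (θ := θ) hcomm hP, iSup_le_iff]
  intro χ v hv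
  have hφv : χ (φ x) • v = χ x • v := by
    by_cases hχ : weightSpace θ χ = ⊥
    · rw [hχ, Submodule.mem_bot] at hv
      rw [hv, smul_zero, smul_zero]
    · exact congrArg (· • v) (congrFun (congrArg Subtype.val (congrFun F_eq ⟨χ, hχ⟩)) x)
  rw [LinearMap.mem_eqLocus, mem_weightSpace.1 hv, hφv]
  exact (mem_weightSpace.1 hv x).symm

end Weights

section HallHigman

theorem map_commutatorElement_eq_one {P M : Type*} [Group P] [Monoid M] {σ : P →* M} {x y : P}
    (h : Commute (σ x) (σ y)) : σ ⁅x, y⁆ = 1 := by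
  rw [commutatorElement_def, map_mul, map_mul, map_mul, h.eq, mul_assoc (σ y), ← map_mul σ x,
    mul_inv_cancel, map_one, mul_one, ← map_mul, mul_inv_cancel, map_one]

variable {E P M : Type*} [Field E] [Group P] [AddCommGroup M] [Module E M]
  [FiniteDimensional E M]

theorem exists_isIrreducible_apply_ne_one (hP : (Nat.card P : E) ≠ 0) {θ : Representation E P M}
    {c : P} (hc : c ∈ Subgroup.center P) (hθc : θ c ≠ 1) :
    ∃ W : Subrepresentation θ, W.toRepresentation.IsIrreducible ∧ W.toRepresentation c ≠ 1 := by
  let U : Subrepresentation θ := ⟨LinearMap.range (θ c - 1), by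
    rintro x _ ⟨v, rfl⟩
    refine ⟨θ x v, ?_⟩
    simp only [LinearMap.sub_apply, Module.End.one_apply, map_sub]
    simp only [← Module.End.mul_apply, ← map_mul, Subgroup.mem_center_iff.1 hc x]⟩
  have hU : U ≠ ⊥ := fun h => hθc <| sub_eq_zero.1 <| LinearMap.range_eq_bot.1 <|
    congrArg Subrepresentation.toSubmodule h
  obtain ⟨W, hWU, hW⟩ := exists_isIrreducible_le hU
  refine ⟨W, hW, fun hWc => ?_⟩
  have : Nontrivial W.toSubmodule :=
    IsSimpleModule.nontrivial (MonoidAlgebra E P) W.toRepresentation.asModule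
  obtain ⟨w, hw⟩ := exists_ne (0 : W.toSubmodule)
  obtain ⟨v, hv⟩ : (w : M) ∈ LinearMap.range (θ c - 1) := hWU w.2
  have hcw : θ c w = w := congrArg Subtype.val (LinearMap.congr_fun hWc w)
  have hcv : θ c v = v + w := by simp [← hv]
  have iterate_eq (k : ℕ) : θ (c ^ k) v = v + k • (w : M) := by
    induction k with
    | zero => simp
    | succ k ih =>
      rw [pow_succ', map_mul, Module.End.mul_apply, ih, map_add, map_nsmul, hcw, hcv, succ_nsmul']
      abel
  have hcard : (Nat.card P : E) • (w : M) = 0 := by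
    simpa [Nat.cast_smul_eq_nsmul] using (iterate_eq (Nat.card P)).symm
  exact hw (Subtype.ext ((smul_eq_zero.1 hcard).resolve_left hP))

theorem commute_of_finrank_eq_one (hM : finrank E M = 1) (f g : Module.End E M) : Commute f g := by
  obtain ⟨v, hv⟩ := finrank_le_one_iff.1 hM.le
  obtain ⟨a, ha⟩ := hv (f v)
  obtain ⟨b, hb⟩ := hv (g v)
  refine LinearMap.ext fun w => ?_
  obtain ⟨c, rfl⟩ := hv w
  simp only [Module.End.mul_apply, map_smul, ← ha, ← hb, smul_comm a b]

theorem eq_one_of_sq_modEq_one {ℓ r : ℕ} (hℓ : ℓ.Prime) (hr0 : r ≠ 0) (hr : r + 1 < ℓ)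
    (h : r ^ 2 ≡ 1 [MOD ℓ]) : r = 1 := by
  have hdvd : ℓ ∣ (r - 1) * (r + 1) := by
    have := (Nat.modEq_iff_dvd' (Nat.one_le_pow _ _ (Nat.pos_of_ne_zero hr0))).1 h.symm
    rwa [← one_pow 2, Nat.sq_sub_sq, mul_comm] at this
  rcases hℓ.dvd_mul.1 hdvd with h | h
  · have := Nat.eq_zero_of_dvd_of_lt h (by lia)
    lia
  · exact absurd (Nat.le_of_dvd r.succ_pos h) hr.not_ge

variable [Finite P] [IsAlgClosed E] {ℓ : ℕ} [Fact ℓ.Prime] [CharP E ℓ]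

theorem apply_commutator_eq_one {σ : Representation E P M} [σ.IsIrreducible]
    (hP : (Nat.card P : E) ≠ 0) (hdim : finrank E M + 1 < ℓ) {C : Subgroup P}
    (hC : C ≤ Subgroup.center P) (hindex : C.index ≡ 1 [MOD ℓ])
    (hcomm : commutator P ≤ Subgroup.center P)
    (hmoved : ∀ x, (∀ y, σ ⁅x, y⁆ = 1) → x ∈ C) (x y : P) : σ ⁅x, y⁆ = 1 := by
  have hsq : (finrank E M : E) ^ 2 = C.index :=
    finrank_sq_eq_index σ hP hC fun x hx => by
      obtain ⟨y, hy⟩ := not_forall.1 (mt (hmoved x) hx)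
      exact ⟨y, hcomm (Subgroup.commutator_mem_commutator trivial trivial), hy⟩
  have : Nontrivial M := IsSimpleModule.nontrivial (MonoidAlgebra E P) σ.asModule
  have hsq_mod : finrank E M ^ 2 ≡ 1 [MOD ℓ] :=
    ((CharP.natCast_eq_natCast E ℓ).1 (by exact_mod_cast hsq)).trans hindex
  have hone := eq_one_of_sq_modEq_one Fact.out finrank_pos.ne' hdim hsq_mod
  exact map_commutatorElement_eq_one (commute_of_finrank_eq_one hone (σ x) (σ y))

theorem commute_of_le_eqLocus {θ : Representation E P M} (hθ : Function.Injective θ)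
    (hP : (Nat.card P : E) ≠ 0) (hdim : finrank E M + 1 < ℓ) {φ : P →* P} {s : ℕ}
    (hcop : (ℓ ^ s).Coprime (Nat.card P)) (hφ : φ^[ℓ ^ s] = id)
    (hfix : ∀ Q : Subgroup P, Q < ⊤ → Q ≤ Q.comap φ → Q ≤ φ.eqLocus (.id P))
    (hcomm : commutator P ≤ φ.eqLocus (.id P)) (hcenter : φ.eqLocus (.id P) ≤ Subgroup.center P)
    (x y : P) : Commute x y := by
  by_contra hxy
  have mem_commutator (x y : P) : ⁅x, y⁆ ∈ commutator P :=
    Subgroup.commutator_mem_commutator trivial trivial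
  obtain ⟨W, hW, hWc⟩ := exists_isIrreducible_apply_ne_one hP
    (hcenter (hcomm (mem_commutator x y))) (θ := θ) fun h =>
      hxy (commutatorElement_eq_one_iff_commute.1 (hθ (h.trans θ.map_one.symm)))
  have hWdim : finrank E W.toSubmodule + 1 < ℓ := by
    grw [Submodule.finrank_le]
    exact hdim
  let R : Subgroup P := (Subgroup.center (P ⧸ W.toRepresentation.ker)).comap (QuotientGroup.mk' _)
  have mem_R {x : P} : x ∈ R ↔ ∀ y, W.toRepresentation ⁅x, y⁆ = 1 := by
    rw [Subgroup.mem_comap, Subgroup.mem_center_iff, (QuotientGroup.mk'_surjective _).forall]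
    refine forall_congr' fun y => ?_
    rw [← MonoidHom.mem_ker, ← QuotientGroup.eq_one_iff, ← QuotientGroup.mk'_apply,
      map_commutatorElement, commutatorElement_eq_one_iff_mul_comm, eq_comm]
  have hR : R ≤ φ.eqLocus (.id P) := by
    refine hfix R (lt_top_iff_ne_top.2 fun h => hWc (mem_R.1 (h ▸ Subgroup.mem_top x) y)) ?_
    intro x hx
    refine mem_R.2 fun y => ?_
    obtain ⟨z, rfl⟩ : ∃ z, φ z = y := ⟨φ^[ℓ ^ s - 1] y, by
      rw [← Function.iterate_succ_apply' φ, Nat.succ_eq_add_one,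
        Nat.sub_add_cancel (Nat.one_le_pow _ _ (Fact.out : ℓ.Prime).pos), hφ, id]⟩
    rw [← map_commutatorElement, show φ ⁅x, z⁆ = ⁅x, z⁆ from hcomm (mem_commutator x z)]
    exact mem_R.1 hx z
  exact hWc (apply_commutator_eq_one hP hWdim hcenter (index_eqLocus_modEq_one hcop hφ)
    (hcomm.trans hcenter) (fun x hx => hR (mem_R.2 hx)) x y)

theorem eq_id_of_finrank_add_one_lt [Group.IsSolvable P] {θ : Representation E P M}
    (hθ : Function.Injective θ) (hP : (Nat.card P : E) ≠ 0) (hdim : finrank E M + 1 < ℓ)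
    {φ : P →* P} {s : ℕ} (hφ : φ^[ℓ ^ s] = id) {S : Module.End E M} (hS : Function.Injective S)
    (hSφ : ∀ x v, S (θ (φ x) v) = θ x (S v)) : φ = MonoidHom.id P := by
  have hℓ : ℓ.Prime := Fact.out
  have hcop : (ℓ ^ s).Coprime (Nat.card P) :=
    Nat.Coprime.pow_left s (hℓ.coprime_iff_not_dvd.2 ((CharP.cast_eq_zero_iff E ℓ _).not.1 hP))
  induction hn : Nat.card P using Nat.strong_induction_on generalizing P with
  | _ n ih =>
  have hfix (Q : Subgroup P) (hQ : Q < ⊤) (hφQ : Q ≤ Q.comap φ) : Q ≤ φ.eqLocus (.id P) := by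
    let ψ : Q →* Q := (φ.domRestrict Q).codRestrict Q fun x => hφQ x.2
    have hψ : ψ^[ℓ ^ s] = id := by
      have : Function.Semiconj Q.subtype ψ φ := fun _ => rfl
      funext x
      exact Subtype.ext <| ((this.iterate_right _).eq x).trans (congrFun hφ x)
    have hcard : Nat.card Q < n := by
      obtain ⟨x, -, hx⟩ := SetLike.exists_of_lt hQ
      exact hn ▸ Finite.card_subtype_lt hx
    have hψ_id := ih _ hcard (θ := θ.comp Q.subtype) (hθ.comp Q.subtype_injective)
      (fun h => hP ((CharP.cast_eq_zero_iff E ℓ _).2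
        (((CharP.cast_eq_zero_iff E ℓ _).1 h).trans Q.card_subgroup_dvd_card)))
      hψ (fun x v => hSφ x v) (hcop.of_dvd_right Q.card_subgroup_dvd_card) rfl
    intro x hx
    exact congrArg Subtype.val (DFunLike.congr_fun hψ_id ⟨x, hx⟩)
  by_contra hne
  have : Nontrivial P := by
    by_contra h
    rw [not_nontrivial_iff_subsingleton] at h
    exact hne (MonoidHom.ext fun x => Subsingleton.elim _ _)
  have hcomm := commutator_le_eqLocus hfix
  have : (φ.eqLocus (.id P)).Normal := Subgroup.commutator_top_left_le_iff.1 <|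
    (Subgroup.commutator_mono le_rfl le_top).trans hcomm
  have hcenter := le_center_of_le_eqLocus hcop hφ hne hfix (le_refl (φ.eqLocus (.id P)))
  exact hne (eq_id_of_commute_of_finrank_lt
    (commute_of_le_eqLocus hθ hP hdim hcop hφ hfix hcomm hcenter) hP hℓ (by lia) hθ hφ hS hSφ)

end HallHigman

theorem commute_of_injective {E M G : Type*} [Field E] [IsAlgClosed E] [AddCommGroup M]
    [Module E M] [FiniteDimensional E M] [Group G] {ℓ s : ℕ} [Fact ℓ.Prime] [CharP E ℓ]
    {θ : Representation E G M} (hθ : Function.Injective θ) (hdim : finrank E M + 1 < ℓ)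
    {H : Subgroup G} [H.Normal] [Finite H] [Group.IsSolvable H] (hH : (Nat.card H : E) ≠ 0)
    {g h : G} (hg : g ^ ℓ ^ s = 1) (hh : h ∈ H) : Commute g h := by
  let φ : MulAut H := MulAut.conjNormal g
  have iterate_φ : φ^[ℓ ^ s] = id := by
    rw [← hom_coe_pow (fun ψ : MulAut H => (ψ : H → H)) rfl (fun _ _ => rfl), ← map_pow, hg,
      map_one]
    rfl
  have hφ := eq_id_of_finrank_add_one_lt (θ := θ.comp H.subtype) (hθ.comp H.subtype_injective) hH
    hdim (φ := φ.toMonoidHom) iterate_φ (S := θ g⁻¹) (θ.apply_bijective g⁻¹).1 fun x v => by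
      simp only [MonoidHom.comp_apply, ← Module.End.mul_apply, ← map_mul]
      congr 2
      simp [φ, mul_assoc]
  have hgh : φ ⟨h, hh⟩ = ⟨h, hh⟩ := DFunLike.congr_fun hφ _
  exact mul_inv_eq_iff_eq_mul.1 (congrArg Subtype.val hgh)

theorem commute_apply_of_finrank_add_one_lt {F M G : Type*} [Field F] [AddCommGroup M]
    [Module F M] [FiniteDimensional F M] [Group G] {ℓ s : ℕ} [Fact ℓ.Prime] [CharP F ℓ]
    (θ : Representation F G M) (hdim : finrank F M + 1 < ℓ) {H : Subgroup G} [H.Normal] [Finite H]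
    [Group.IsSolvable H] (hH : (Nat.card H : F) ≠ 0) {g h : G} (hg : g ^ ℓ ^ s = 1) (hh : h ∈ H) :
    Commute (θ g) (θ h) := by
  let E := AlgebraicClosure F
  let ψ : Module.End F M →* Module.End E (TensorProduct F E M) :=
    (Module.End.baseChangeHom F E M).toRingHom.toMonoidHom
  have hψ : Function.Injective ψ := LinearMap.baseChangeHom_injective F M E
  let Θ := (ψ.comp θ).toHomUnits
  let H' := H.map Θ.rangeRestrict
  have : H'.Normal := Subgroup.Normal.map ‹_› _ Θ.rangeRestrict_surjective
  have : Finite H' := Set.Finite.image _ (Set.toFinite (H : Set G))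
  have surjective := Θ.rangeRestrict.subgroupMap_surjective H
  have : Group.IsSolvable H' := Group.isSolvable_of_surjective surjective
  have : CharP E ℓ := charP_of_injective_algebraMap (algebraMap F E).injective ℓ
  have hH' : (Nat.card H' : E) ≠ 0 := by
    rw [Ne, CharP.cast_eq_zero_iff E ℓ]
    rw [Ne, CharP.cast_eq_zero_iff F ℓ] at hH
    exact mt (fun h => h.trans (Subgroup.card_dvd_of_surjective _ surjective)) hH
  have hg' : Θ.rangeRestrict g ^ ℓ ^ s = 1 := by rw [← map_pow, hg, map_one]
  have commute := commute_of_injective (θ := (Units.coeHom _).comp Θ.range.subtype)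
    (Units.val_injective.comp Subtype.val_injective) (by rwa [finrank_baseChange]) hH' hg'
    (Subgroup.mem_map_of_mem Θ.rangeRestrict hh)
  exact .of_map hψ (commute.map ((Units.coeHom _).comp Θ.range.subtype))

theorem commute_apply_of_length_add_one_lt {R M G : Type*} [CommRing R] [IsLocalRing R]
    [AddCommGroup M] [Module R M] [Module.Finite R M] [Group G] {ℓ s : ℕ} [Fact ℓ.Prime]
    [CharP (IsLocalRing.ResidueField R) ℓ]
    (hM : ∀ r ∈ IsLocalRing.maximalIdeal R, ∀ x : M, r • x = 0)
    (θ : Representation R G M) (hlen : Module.length R M + 1 < ℓ) {H : Subgroup G} [H.Normal]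
    [Finite H] [Group.IsSolvable H] (hH : IsUnit (Nat.card H : R)) {g h : G}
    (hg : g ^ ℓ ^ s = 1) (hh : h ∈ H) : Commute (θ g) (θ h) := by
  let k := IsLocalRing.ResidueField R
  have surjective : Function.Surjective (algebraMap R k) := IsLocalRing.residue_surjective
  have torsion : Module.IsTorsionBySet R M (IsLocalRing.maximalIdeal R : Set R) :=
    fun x r => hM r.1 r.2 x
  let _ : Module k M := torsion.module
  have : IsScalarTower R k M := torsion.isScalarTower
  have : Module.Finite k M := Module.Finite.of_restrictScalars_finite R k M
  let θ' : Representation k G M :=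
    { toFun := fun g => (θ g).extendScalarsOfSurjective surjective
      map_one' := by ext x; simp
      map_mul' := fun g g' => by ext x; simp }
  rw [Module.length_eq_of_surjective surjective, Module.length_eq_finrank] at hlen
  have hHk : (Nat.card H : k) ≠ 0 := by
    rw [← map_natCast (algebraMap R k)]
    exact (hH.map (algebraMap R k)).ne_zero
  have commute := commute_apply_of_finrank_add_one_lt θ' (by exact_mod_cast hlen) hHk hg hh
  exact LinearMap.ext fun x => LinearMap.congr_fun commute x

section RelativeLength

variable {R V : Type*} [CommRing R] [AddCommGroup V] [Module R V]

/-- The length of `L ⧸ (T ⊓ L)`, which for `T ≤ L` is the relative index `[L : T]`. -/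
noncomputable def relLength (T L : Submodule R V) : ℕ∞ := Module.length R (L ⧸ T.submoduleOf L)

theorem relLength_add {T L P : Submodule R V} (hTL : T ≤ L) (hLP : L ≤ P) :
    relLength T P = relLength T L + relLength L P := by
  let f : (L ⧸ T.submoduleOf L) →ₗ[R] (P ⧸ T.submoduleOf P) :=
    Submodule.mapQ _ _ (Submodule.inclusion hLP) fun _ hx => hx
  let g : (P ⧸ T.submoduleOf P) →ₗ[R] (P ⧸ L.submoduleOf P) :=
    Submodule.factor fun _ hx => hTL hx
  refine Module.length_eq_add_of_exact f g ?_ (Submodule.factor_surjective _) ?_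
  · refine LinearMap.ker_eq_bot.1 (LinearMap.ker_eq_bot'.2 fun x hx => ?_)
    obtain ⟨x, rfl⟩ := Submodule.Quotient.mk_surjective _ x
    exact (Submodule.Quotient.mk_eq_zero _).2 ((Submodule.Quotient.mk_eq_zero _).1 hx :)
  · intro y
    obtain ⟨y, rfl⟩ := Submodule.Quotient.mk_surjective _ y
    constructor
    · intro h
      have hy : y ∈ L.submoduleOf P := (Submodule.Quotient.mk_eq_zero _).1 h
      exact ⟨Submodule.Quotient.mk ⟨y.1, hy⟩, rfl⟩
    · rintro ⟨x, hx⟩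
      obtain ⟨x, rfl⟩ := Submodule.Quotient.mk_surjective _ x
      rw [← hx]
      exact (Submodule.Quotient.mk_eq_zero _).2 x.2

theorem relLength_eq_zero_iff {T L : Submodule R V} : relLength T L = 0 ↔ L ≤ T := by
  rw [relLength, Module.length_eq_zero_iff, Submodule.Quotient.subsingleton_iff,
    Submodule.submoduleOf_eq_top]

theorem relLength_anti {T T' L : Submodule R V} (h : T ≤ T') (h' : T' ≤ L) :
    relLength T' L ≤ relLength T L :=
  le_add_self.trans_eq (relLength_add h h').symm

theorem relLength_map (T L : Submodule R V) {φ : Module.End R V} (hφ : Function.Injective φ) :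
    relLength (T.map φ) (L.map φ) = relLength T L := by
  refine (LinearEquiv.length_eq (Submodule.Quotient.equiv _ _
    (Submodule.equivMapOfInjective φ hφ L) ?_)).symm
  ext x
  obtain ⟨y, rfl⟩ := (Submodule.equivMapOfInjective φ hφ L).surjective x
  simp [Submodule.submoduleOf, hφ.eq_iff]

theorem map_pow_le {L : Submodule R V} {φ : Module.End R V} (hL : L.map φ ≤ L) (k : ℕ) :
    L.map (φ ^ k) ≤ L := by
  induction k with
  | zero => exact (Submodule.map_id L).le
  | succ k ih =>
    rw [pow_succ', Module.End.mul_eq_comp, Submodule.map_comp]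
    exact (Submodule.map_mono ih).trans hL

theorem relLength_map_pow {L : Submodule R V} {φ : Module.End R V} (hφ : Function.Injective φ)
    (hL : L.map φ ≤ L) (k : ℕ) :
    relLength (L.map (φ ^ k)) L = k * relLength (L.map φ) L := by
  induction k with
  | zero => rw [Nat.cast_zero, zero_mul, relLength_eq_zero_iff]; exact (Submodule.map_id L).ge
  | succ k ih =>
    rw [pow_succ', Module.End.mul_eq_comp, Submodule.map_comp,
      relLength_add (Submodule.map_mono (map_pow_le hL k)) hL, relLength_map _ _ hφ, ih]
    push_cast
    ring

end RelativeLength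

theorem lsmul_injective_of_ne_zero {𝒪 V : Type*} (K : Type*) [CommRing 𝒪] [Field K] [Algebra 𝒪 K]
    [IsFractionRing 𝒪 K] [AddCommGroup V] [Module K V] [Module 𝒪 V] [IsScalarTower 𝒪 K V]
    {a : 𝒪} (ha : a ≠ 0) : Function.Injective (LinearMap.lsmul 𝒪 V a) := fun _ _ h =>
  smul_right_injective V (r := algebraMap 𝒪 K a) (by simpa using ha) (by simpa using h)

section Lattice

variable {𝒪 K V : Type*} [CommRing 𝒪] [Field K] [Algebra 𝒪 K]
  [AddCommGroup V] [Module K V] [Module 𝒪 V] [IsScalarTower 𝒪 K V]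

theorem map_lsmul_le (L : Submodule 𝒪 V) (a : 𝒪) : L.map (LinearMap.lsmul 𝒪 V a) ≤ L :=
  Submodule.map_le_iff_le_comap.2 fun _ hx => L.smul_mem a hx

theorem isLattice_span_range_basis {ι : Type*} [Finite ι] (b : Basis ι K V) :
    Submodule.IsLattice K (Submodule.span 𝒪 (Set.range b)) where
  fg := Submodule.fg_span (Set.finite_range b)
  span_eq_top := by rw [Submodule.span_span_of_tower, b.span_eq]

variable [IsFractionRing 𝒪 K]

theorem smul_inv_algebraMap_smul {a : 𝒪} (ha : a ≠ 0) (x : V) :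
    a • (algebraMap 𝒪 K a)⁻¹ • x = x := by
  rw [← algebraMap_smul K a, smul_inv_smul₀ (by simpa using ha)]

variable [IsDomain 𝒪] [IsDiscreteValuationRing 𝒪]

variable (K) in
theorem exists_pow_smul_mem {π : 𝒪} (hπ : Irreducible π) (T : Submodule 𝒪 V)
    [Submodule.IsLattice K T] (x : V) : ∃ m : ℕ, π ^ m • x ∈ T := by
  have hx : x ∈ Submodule.span K (T : Set V) :=
    (Submodule.IsLattice.span_eq_top (M := T)).ge Submodule.mem_top
  obtain ⟨y, hy, s, rfl⟩ := (IsLocalization.mem_span_iff (nonZeroDivisors 𝒪)).1 hx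
  rw [Submodule.span_eq] at hy
  obtain ⟨m, u, hu⟩ :=
    IsDiscreteValuationRing.eq_unit_mul_pow_irreducible (nonZeroDivisors.ne_zero s.2) hπ
  refine ⟨m, ?_⟩
  have hπm : π ^ m = (↑u⁻¹ : 𝒪) * s := by rw [hu, Units.inv_mul_cancel_left]
  have hs : (s : 𝒪) • IsLocalization.mk' K 1 s • y = y := by
    rw [← algebraMap_smul K (s : 𝒪), smul_smul, mul_comm, IsLocalization.mk'_spec, map_one,
      one_smul]
  rw [hπm, mul_smul, hs]
  exact T.smul_mem _ hy

variable (K) in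
theorem exists_forall_pow_smul_mem {π : 𝒪} (hπ : Irreducible π) (T : Submodule 𝒪 V)
    [Submodule.IsLattice K T] {L : Submodule 𝒪 V} (hL : L.FG) :
    ∃ m : ℕ, ∀ x ∈ L, π ^ m • x ∈ T := by
  obtain ⟨s, rfl⟩ := hL
  choose m hm using exists_pow_smul_mem K hπ T
  refine ⟨s.sup m, fun x hx => ?_⟩
  suffices h : Submodule.span 𝒪 s ≤ T.comap (LinearMap.lsmul 𝒪 V (π ^ s.sup m)) from h hx
  refine Submodule.span_le.2 fun y hy => ?_
  obtain ⟨k, hk⟩ := Nat.exists_eq_add_of_le' (Finset.le_sup (f := m) hy)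
  rw [SetLike.mem_coe, Submodule.mem_comap, LinearMap.lsmul_apply, hk, pow_add, mul_smul]
  exact T.smul_mem _ (hm y)

theorem exists_basis_span_eq (T : Submodule 𝒪 V) [Submodule.IsLattice K T] :
    ∃ b : Basis (Fin (finrank K V)) K V, T = Submodule.span 𝒪 (Set.range b) := by
  have : Module.Free 𝒪 T := Submodule.IsLattice.free K T
  have hr : finrank 𝒪 T = finrank K V := by
    rw [finrank, finrank, Submodule.IsLattice.rank' K T]
  let b := Module.finBasisOfFinrankEq 𝒪 T hr
  refine ⟨b.extendOfIsLattice K, ?_⟩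
  have hb : Set.range (b.extendOfIsLattice K) = T.subtype '' Set.range b := by
    rw [← Set.range_comp]
    congr 1
    ext i
    simp
  rw [hb, ← Submodule.map_span, b.span_eq, Submodule.map_top, Submodule.range_subtype]

theorem relLength_map_uniformizer {π : 𝒪} (hπ : Irreducible π) (L : Submodule 𝒪 V)
    [Submodule.IsLattice K L] :
    relLength (L.map (LinearMap.lsmul 𝒪 V π)) L = finrank K V := by
  have : Module.Free 𝒪 L := Submodule.IsLattice.free K L
  have hr : finrank 𝒪 L = finrank K V := by
    rw [finrank, finrank, Submodule.IsLattice.rank' K L]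
  have hsimple : Module.length 𝒪 (𝒪 ⧸ Ideal.span {π}) = 1 := by
    rw [Module.length_eq_one_iff, isSimpleModule_iff_isCoatom, ← hπ.maximalIdeal_eq]
    exact (IsLocalRing.maximalIdeal.isMaximal 𝒪).out
  let b := Module.finBasis 𝒪 L
  let e : (L ⧸ (L.map (LinearMap.lsmul 𝒪 V π)).submoduleOf L) ≃ₗ[𝒪]
      ((Fin (finrank 𝒪 L) → 𝒪) ⧸ Submodule.pi Set.univ (fun _ => Ideal.span {π})) := by
    refine Submodule.Quotient.equiv _ _ b.equivFun ?_
    ext x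
    simp only [Submodule.mem_map, Submodule.mem_pi, Set.mem_univ, true_imp_iff,
      Ideal.mem_span_singleton]
    constructor
    · rintro ⟨y, ⟨z, hz, hzy⟩, rfl⟩ i
      rw [show y = π • (⟨z, hz⟩ : L) from Subtype.ext hzy.symm, map_smul]
      exact dvd_mul_right _ _
    · intro h
      choose c hc using h
      refine ⟨b.equivFun.symm x, ⟨b.equivFun.symm c, Subtype.prop _, ?_⟩,
        b.equivFun.apply_symm_apply x⟩
      rw [show x = π • c from funext hc, map_smul]
      rfl
  rw [relLength, e.length_eq, (Submodule.quotientPi _).length_eq, Module.length_pi_of_fintype]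
  simp [hsimple, hr]

theorem relLength_map_uniformizer_pow {π : 𝒪} (hπ : Irreducible π) (L : Submodule 𝒪 V)
    [Submodule.IsLattice K L] (m : ℕ) :
    relLength (L.map (LinearMap.lsmul 𝒪 V (π ^ m))) L = m * finrank K V := by
  rw [show LinearMap.lsmul 𝒪 V (π ^ m) = (LinearMap.lsmul 𝒪 V π : Module.End 𝒪 V) ^ m from
      map_pow (Module.toModuleEnd 𝒪 (S := 𝒪) V) π m,
    relLength_map_pow (lsmul_injective_of_ne_zero K hπ.ne_zero) (map_lsmul_le L π),
    relLength_map_uniformizer (K := K) hπ]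

theorem relLength_map_of_addVal {a : 𝒪} {e : ℕ}
    (ha : IsDiscreteValuationRing.addVal 𝒪 a = e) (L : Submodule 𝒪 V)
    [Submodule.IsLattice K L] :
    relLength (L.map (LinearMap.lsmul 𝒪 V a)) L = e * finrank K V := by
  obtain ⟨π, hπ⟩ := IsDiscreteValuationRing.exists_irreducible 𝒪
  obtain ⟨u, rfl⟩ := (IsDiscreteValuationRing.addVal_eq_iff_associated (π ^ e) a).1
    (by rw [ha, hπ.addVal_pow])
  rw [← relLength_map_uniformizer_pow hπ L e]
  congr 1
  ext x
  constructor
  · rintro ⟨y, hy, rfl⟩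
    exact ⟨(u : 𝒪) • y, L.smul_mem _ hy, by simp [smul_smul, mul_comm]⟩
  · rintro ⟨y, hy, rfl⟩
    exact ⟨(↑u⁻¹ : 𝒪) • y, L.smul_mem _ hy, by simp [smul_smul, mul_left_comm _ (π ^ e)]⟩

theorem relLength_ne_top {T L : Submodule 𝒪 V} [Submodule.IsLattice K T]
    [Submodule.IsLattice K L] (hTL : T ≤ L) : relLength T L ≠ ⊤ := by
  obtain ⟨π, hπ⟩ := IsDiscreteValuationRing.exists_irreducible 𝒪
  obtain ⟨m, hm⟩ := exists_forall_pow_smul_mem K hπ T (L := L) (Submodule.IsLattice.fg (A := K))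
  refine ne_top_of_le_ne_top ?_
    (relLength_anti (Submodule.map_le_iff_le_comap.2 hm : L.map (LinearMap.lsmul 𝒪 V _) ≤ T) hTL)
  rw [relLength_map_uniformizer_pow (K := K) hπ]
  exact WithTop.mul_ne_top (ENat.natCast_ne_top _) (ENat.natCast_ne_top _)

end Lattice

section DualLattice

variable {𝒪 K V : Type*} [CommRing 𝒪] [Field K] [AddCommGroup V] [Module K V]
  {f : LinearMap.BilinForm K V}

theorem nondegenerate_of_isAlt_of_separatingLeft (hf : f.IsAlt) (h : f.SeparatingLeft) :
    f.Nondegenerate :=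
  (LinearMap.IsRefl.nondegenerate_iff_separatingLeft
    (LinearMap.BilinForm.IsAlt.isRefl hf)).2 h

variable [Algebra 𝒪 K]

theorem apply_mem_one_comm (hf : f.IsAlt) {x y : V} :
    f x y ∈ (1 : Submodule 𝒪 K) ↔ f y x ∈ (1 : Submodule 𝒪 K) := by
  rw [← hf.neg_eq, neg_mem_iff]

variable [Module 𝒪 V] [IsScalarTower 𝒪 K V]

theorem le_dualSubmodule_comm (hf : f.IsAlt) {T L : Submodule 𝒪 V} :
    T ≤ f.dualSubmodule L ↔ L ≤ f.dualSubmodule T :=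
  ⟨fun h x hx _ hy => (apply_mem_one_comm hf).1 (h hy x hx),
    fun h x hx _ hy => (apply_mem_one_comm hf).1 (h hy x hx)⟩

theorem dualSubmodule_anti {T L : Submodule 𝒪 V} (h : T ≤ L) :
    f.dualSubmodule L ≤ f.dualSubmodule T :=
  fun _ hx y hy => hx y (h hy)

theorem dualSubmodule_sup (T L : Submodule 𝒪 V) :
    f.dualSubmodule (T ⊔ L) = f.dualSubmodule T ⊓ f.dualSubmodule L := by
  refine le_antisymm (le_inf (dualSubmodule_anti le_sup_left) (dualSubmodule_anti le_sup_right))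
    fun x hx z hz => ?_
  obtain ⟨t, ht, l, hl, rfl⟩ := Submodule.mem_sup.1 hz
  rw [map_add]
  exact add_mem (hx.1 t ht) (hx.2 l hl)

theorem mem_dualSubmodule_smul {c : 𝒪} {T : Submodule 𝒪 V} {x : V} :
    x ∈ (algebraMap 𝒪 K c • f).dualSubmodule T ↔ c • x ∈ f.dualSubmodule T := by
  simp only [LinearMap.BilinForm.mem_dualSubmodule, LinearMap.smul_apply, ← algebraMap_smul K c x,
    map_smul]

variable [IsDomain 𝒪] [IsDiscreteValuationRing 𝒪] [IsFractionRing 𝒪 K]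

theorem isLattice_dualSubmodule [FiniteDimensional K V] (hf : f.Nondegenerate)
    (T : Submodule 𝒪 V) [Submodule.IsLattice K T] :
    Submodule.IsLattice K (f.dualSubmodule T) := by
  obtain ⟨b, rfl⟩ := exists_basis_span_eq (K := K) T
  rw [LinearMap.BilinForm.dualSubmodule_span_of_basis f hf b]
  exact isLattice_span_range_basis _

theorem dualSubmodule_dualSubmodule (hf : f.Nondegenerate) (halt : f.IsAlt)
    (T : Submodule 𝒪 V) [Submodule.IsLattice K T] :
    f.dualSubmodule (f.dualSubmodule T) = T := by
  have hflip : f.flip.dualSubmodule T = f.dualSubmodule T := by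
    ext x
    exact forall₂_congr fun y _ => apply_mem_one_comm halt
  obtain ⟨b, rfl⟩ := exists_basis_span_eq (K := K) T
  rw [← hflip, LinearMap.BilinForm.dualSubmodule_dualSubmodule_flip_of_basis f hf b]

end DualLattice

section IntegralLattice

variable {𝒪 K V G : Type*} [CommRing 𝒪] [Field K] [AddCommGroup V] [Module K V] [Module 𝒪 V]
  [Group G]

/-- Stability of an `𝒪`-submodule under a `K`-linear action of `G`. -/
def IsStable (ρ : Representation K G V) (T : Submodule 𝒪 V) : Prop :=
  ∀ (g : G), ∀ x ∈ T, ρ g x ∈ T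

variable {ρ : Representation K G V} {T L : Submodule 𝒪 V}

theorem IsStable.sup (hT : IsStable ρ T) (hL : IsStable ρ L) : IsStable ρ (T ⊔ L) := by
  intro g x hx
  obtain ⟨t, ht, l, hl, rfl⟩ := Submodule.mem_sup.1 hx
  rw [map_add]
  exact Submodule.add_mem_sup (hT g t ht) (hL g l hl)

theorem IsStable.map (hT : IsStable ρ T) {φ : Module.End 𝒪 V}
    (hφ : ∀ g x, φ (ρ g x) = ρ g (φ x)) : IsStable ρ (T.map φ) := by
  rintro g _ ⟨x, hx, rfl⟩
  exact ⟨ρ g x, hT g x hx, hφ g x⟩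

/-- A symplectic structure on the `K[G]`-module `V`: a nondegenerate alternating `G`-invariant
form. -/
structure IsSymplecticForm (ρ : Representation K G V) (f : LinearMap.BilinForm K V) : Prop where
  nondegenerate : f.Nondegenerate
  isAlt : f.IsAlt
  invariant : ∀ (g : G) (x y : V), f (ρ g x) (ρ g y) = f x y

variable [Algebra 𝒪 K] [IsScalarTower 𝒪 K V]

/-- A `G`-stable lattice on which `f` takes values in `𝒪`, the latter being expressed as the
inclusion of `T` in its `f`-dual. -/
structure IsIntegralLattice (ρ : Representation K G V) (f : LinearMap.BilinForm K V)
    (T : Submodule 𝒪 V) : Prop where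
  isLattice : Submodule.IsLattice K T
  isStable : IsStable ρ T
  le_dual : T ≤ f.dualSubmodule T

variable {f : LinearMap.BilinForm K V}

theorem exists_isLattice_isStable (𝒪 : Type*) [CommRing 𝒪] [Algebra 𝒪 K] [Module 𝒪 V]
    [IsScalarTower 𝒪 K V] [Finite G] [FiniteDimensional K V] (ρ : Representation K G V) :
    ∃ T : Submodule 𝒪 V, Submodule.IsLattice K T ∧ IsStable ρ T := by
  let L : Submodule 𝒪 V := Submodule.span 𝒪 (Set.range (Module.finBasis K V))
  have hL : Submodule.IsLattice K L := isLattice_span_range_basis _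
  let T : Submodule 𝒪 V := ⨆ g : G, L.map ((ρ g).restrictScalars 𝒪)
  have hLT : L ≤ T := fun x hx => Submodule.mem_iSup_of_mem 1 ⟨x, hx, by simp⟩
  refine ⟨T, .of_le_of_isLattice_of_fg K hLT (Submodule.fg_iSup _ fun g => hL.fg.map _),
    fun g x hx => ?_⟩
  suffices h : T ≤ T.comap ((ρ g).restrictScalars 𝒪) from h hx
  refine iSup_le fun g' => ?_
  rintro _ ⟨y, hy, rfl⟩
  exact Submodule.mem_iSup_of_mem (g * g') ⟨y, hy, by simp⟩

namespace IsSymplecticForm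

theorem smul (hf : IsSymplecticForm ρ f) {c : K} (hc : c ≠ 0) : IsSymplecticForm ρ (c • f) where
  nondegenerate := nondegenerate_of_isAlt_of_separatingLeft (fun x => by simp [hf.isAlt x])
    fun x hx => hf.nondegenerate.1 x fun y => by simpa [hc] using hx y
  isAlt := fun x => by simp [hf.isAlt x]
  invariant := fun g x y => by simp [hf.invariant g x y]

theorem apply_left (hf : IsSymplecticForm ρ f) (g : G) (x y : V) :
    f (ρ g x) y = f x (ρ g⁻¹ y) := by
  rw [← hf.invariant g x (ρ g⁻¹ y), Representation.self_inv_apply]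

theorem isStable_dualSubmodule (hf : IsSymplecticForm ρ f) (hT : IsStable ρ T) :
    IsStable ρ (f.dualSubmodule T) := by
  intro g x hx y hy
  rw [hf.apply_left]
  exact hx _ (hT _ y hy)

theorem le_of_maximal (hf : IsSymplecticForm ρ f) (hT : Maximal (IsIntegralLattice ρ f) T)
    {N : Submodule 𝒪 V} (hfg : N.FG) (hstable : IsStable ρ N) (hNT : N ≤ f.dualSubmodule T)
    (hNN : N ≤ f.dualSubmodule N) : N ≤ T := by
  have := hT.prop.isLattice
  have hTN : T ⊔ N ≤ f.dualSubmodule (T ⊔ N) := by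
    rw [dualSubmodule_sup]
    exact sup_le (le_inf hT.prop.le_dual ((le_dualSubmodule_comm hf.isAlt).1 hNT)) (le_inf hNT hNN)
  exact le_sup_right.trans (hT.le_of_ge
    ⟨.of_le_of_isLattice_of_fg K le_sup_left (this.fg.sup hfg), hT.prop.isStable.sup hstable, hTN⟩
    le_sup_left)

variable [IsDomain 𝒪] [IsDiscreteValuationRing 𝒪] [IsFractionRing 𝒪 K]

theorem relLength_dual_smul (hf : IsSymplecticForm ρ f) [Submodule.IsLattice K T] {π : 𝒪}
    (hπ : π ≠ 0) :
    relLength (f.dualSubmodule T) ((algebraMap 𝒪 K π • f).dualSubmodule (f.dualSubmodule T)) =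
      relLength ((f.dualSubmodule T).map (LinearMap.lsmul 𝒪 V π)) T := by
  rw [← relLength_map _ _ (lsmul_injective_of_ne_zero K hπ)]
  congr 1
  have hmem : ∀ y, y ∈ (algebraMap 𝒪 K π • f).dualSubmodule (f.dualSubmodule T) ↔ π • y ∈ T :=
    fun y => by
      rw [mem_dualSubmodule_smul, dualSubmodule_dualSubmodule hf.nondegenerate hf.isAlt]
  ext x
  refine ⟨fun ⟨y, hy, hyx⟩ => hyx ▸ (hmem y).1 hy,
    fun hx => ⟨_, (hmem _).2 ?_, smul_inv_algebraMap_smul (K := K) hπ x⟩⟩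
  rwa [smul_inv_algebraMap_smul hπ]

variable [FiniteDimensional K V]

-- As long as `D ^ (k + 2)` maps the dual `L` into `T`, the form is integral on `D ^ (k + 1) L`,
-- because `f (D ^ (k + 1) x) (D ^ (k + 1) y) = f (D ^ k x) (U (D ^ (k + 2) y))`.
theorem apply_mem_of_maximal (hf : IsSymplecticForm ρ f) (hT : Maximal (IsIntegralLattice ρ f) T)
    {D U : Module.End 𝒪 V} (hDρ : ∀ g x, D (ρ g x) = ρ g (D x))
    (hadj : ∀ x y, f (D x) y = f x (U (D y))) (hDT : ∀ x ∈ T, D x ∈ T) (hUT : ∀ x ∈ T, U x ∈ T)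
    {m : ℕ} (hm : ∀ x ∈ f.dualSubmodule T, (D ^ (m + 1)) x ∈ T) :
    ∀ x ∈ f.dualSubmodule T, D x ∈ T := by
  have := hT.prop.isLattice
  have hfg : (f.dualSubmodule T).FG := (isLattice_dualSubmodule hf.nondegenerate T).fg
  have hDL : ∀ k, ∀ x ∈ f.dualSubmodule T, (D ^ k) x ∈ f.dualSubmodule T := by
    intro k x hx
    exact map_pow_le (L := f.dualSubmodule T) (φ := D) (Submodule.map_le_iff_le_comap.2
      fun y hy t ht => hadj y t ▸ hy _ (hUT _ (hDT t ht))) k ⟨x, hx, rfl⟩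
  have hDρ_pow : ∀ k g x, (D ^ k) (ρ g x) = ρ g ((D ^ k) x) := by
    intro k g
    induction k with
    | zero => simp
    | succ k ih => intro x; simp only [pow_succ', Module.End.mul_apply, ih, hDρ]
  induction m with
  | zero => simpa using hm
  | succ k ih =>
    refine ih fun x hx => ?_
    refine hf.le_of_maximal hT (hfg.map (D ^ (k + 1)))
      ((hf.isStable_dualSubmodule hT.prop.isStable).map (hDρ_pow _))
      (Submodule.map_le_iff_le_comap.2 (hDL _)) ?_ ⟨x, hx, rfl⟩
    rintro _ ⟨x, hx, rfl⟩ _ ⟨y, hy, rfl⟩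
    rw [pow_succ', Module.End.mul_apply, hadj, ← Module.End.mul_apply D, ← pow_succ', ← pow_succ']
    exact hDL k x hx _ (hUT _ (hm y hy))

theorem uniformizer_smul_mem_of_maximal (hf : IsSymplecticForm ρ f)
    (hT : Maximal (IsIntegralLattice ρ f) T) {π : 𝒪} (hπ : Irreducible π) :
    ∀ x ∈ f.dualSubmodule T, π • x ∈ T := by
  have := hT.prop.isLattice
  obtain ⟨m, hm⟩ := exists_forall_pow_smul_mem K hπ T
    (isLattice_dualSubmodule hf.nondegenerate T).fg
  refine hf.apply_mem_of_maximal hT (D := Module.toModuleEnd 𝒪 (S := 𝒪) V π) (U := 1) (m := m)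
    (fun g x => (LinearMap.map_smul_of_tower (ρ g) π x).symm) (fun x y => ?_)
    (fun x hx => T.smul_mem π hx) (fun x hx => hx) fun x hx => ?_
  · simp [LinearMap.map_smul_of_tower]
  · rw [← map_pow, pow_succ']
    simpa [mul_smul] using T.smul_mem π (hm x hx)

theorem exists_isIntegralLattice [Finite G] (𝒪 : Type*) [CommRing 𝒪] [IsDomain 𝒪]
    [IsDiscreteValuationRing 𝒪] [Algebra 𝒪 K] [IsFractionRing 𝒪 K] [Module 𝒪 V]
    [IsScalarTower 𝒪 K V] (hf : IsSymplecticForm ρ f) :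
    ∃ (f' : LinearMap.BilinForm K V) (T : Submodule 𝒪 V),
      IsSymplecticForm ρ f' ∧ IsIntegralLattice ρ f' T := by
  obtain ⟨π, hπ⟩ := IsDiscreteValuationRing.exists_irreducible 𝒪
  obtain ⟨T, hT, hstable⟩ := exists_isLattice_isStable 𝒪 ρ
  have := isLattice_dualSubmodule hf.nondegenerate T
  obtain ⟨m, hm⟩ := exists_forall_pow_smul_mem K hπ (f.dualSubmodule T) hT.fg
  exact ⟨algebraMap 𝒪 K (π ^ m) • f, T, hf.smul (by simpa using pow_ne_zero m hπ.ne_zero), hT,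
    hstable, fun x hx => mem_dualSubmodule_smul.2 (hm x hx)⟩

theorem relLength_dual_lt (hf : IsSymplecticForm ρ f) {T' : Submodule 𝒪 V}
    (hT' : IsIntegralLattice ρ f T') (h : T < T') :
    relLength T' (f.dualSubmodule T') < relLength T (f.dualSubmodule T) := by
  have := hT'.isLattice
  have := isLattice_dualSubmodule hf.nondegenerate T'
  have hdual := dualSubmodule_anti (f := f) h.le
  rw [relLength_add h.le (hT'.le_dual.trans hdual), relLength_add hT'.le_dual hdual]
  have hpos : 0 < relLength T T' := pos_of_ne_zero fun h0 => h.not_ge (relLength_eq_zero_iff.1 h0)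
  exact (ENat.lt_add_left (relLength_ne_top (K := K) hT'.le_dual) hpos).trans_le
    (by gcongr; exact le_self_add)

-- Choose a form and an integral lattice `T` with discriminant `L / T` of minimal length, where `L`
-- is the dual of `T`. The bound follows by comparison with the lattice `L` and the form `π f`,
-- whose discriminant is `T / π L`.
theorem exists_maximal_isIntegralLattice [Finite G] (𝒪 : Type*) [CommRing 𝒪] [IsDomain 𝒪]
    [IsDiscreteValuationRing 𝒪] [Algebra 𝒪 K] [IsFractionRing 𝒪 K] [Module 𝒪 V]
    [IsScalarTower 𝒪 K V] (hf : IsSymplecticForm ρ f) :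
    ∃ (f' : LinearMap.BilinForm K V) (T : Submodule 𝒪 V), IsSymplecticForm ρ f' ∧
      Maximal (IsIntegralLattice ρ f') T ∧ 2 * relLength T (f'.dualSubmodule T) ≤ finrank K V := by
  obtain ⟨f₀, T₀, hf₀, hT₀⟩ := hf.exists_isIntegralLattice 𝒪
  obtain ⟨_, ⟨f', T, hf', hT, rfl⟩, hmin⟩ := wellFounded_lt.has_min
    {N : ℕ∞ | ∃ (f' : LinearMap.BilinForm K V) (T : Submodule 𝒪 V), IsSymplecticForm ρ f' ∧
      IsIntegralLattice ρ f' T ∧ relLength T (f'.dualSubmodule T) = N} ⟨_, f₀, T₀, hf₀, hT₀, rfl⟩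
  have hmax : Maximal (IsIntegralLattice ρ f') T := ⟨hT, fun T' hT' hle => by
    by_contra hnle
    exact hmin _ ⟨f', T', hf', hT', rfl⟩ (hf'.relLength_dual_lt hT' ⟨hle, hnle⟩)⟩
  refine ⟨f', T, hf', hmax, ?_⟩
  obtain ⟨π, hπ⟩ := IsDiscreteValuationRing.exists_irreducible 𝒪
  have := hT.isLattice
  have hdual := isLattice_dualSubmodule hf'.nondegenerate T
  have hsmul := hf'.uniformizer_smul_mem_of_maximal hmax hπ
  have hL : IsIntegralLattice ρ (algebraMap 𝒪 K π • f') (f'.dualSubmodule T) :=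
    ⟨hdual, hf'.isStable_dualSubmodule hT.isStable, fun x hx => by
      rw [mem_dualSubmodule_smul, dualSubmodule_dualSubmodule hf'.nondegenerate hf'.isAlt]
      exact hsmul x hx⟩
  have hle := not_lt.1 (hmin _ ⟨_, _, hf'.smul (by simpa using hπ.ne_zero), hL, rfl⟩)
  rw [hf'.relLength_dual_smul hπ.ne_zero] at hle
  rw [← relLength_map_uniformizer (K := K) hπ (f'.dualSubmodule T),
    relLength_add (Submodule.map_le_iff_le_comap.2 hsmul) hT.le_dual, two_mul]
  gcongr

end IsSymplecticForm

end IntegralLattice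

theorem exists_linearMap_extending {𝒪 K V W : Type*} [CommRing 𝒪] [IsDomain 𝒪]
    [IsPrincipalIdealRing 𝒪] [Field K] [Algebra 𝒪 K] [IsFractionRing 𝒪 K]
    [AddCommGroup V] [Module K V] [Module 𝒪 V] [IsScalarTower 𝒪 K V]
    [AddCommGroup W] [Module K W] [Module 𝒪 W] [IsScalarTower 𝒪 K W]
    {L : Submodule 𝒪 V} [Submodule.IsLattice K L] (p : L →ₗ[𝒪] W) :
    ∃ P : V →ₗ[K] W, ∀ x : L, P x = p x := by
  have : Module.Free 𝒪 L := Submodule.IsLattice.free K L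
  let b := Module.Free.chooseBasis 𝒪 L
  let P := (b.extendOfIsLattice K).constr K (p ∘ b)
  have hP : P.restrictScalars 𝒪 ∘ₗ L.subtype = p := by
    refine b.ext fun j => ?_
    have hj : (b j : V) = b.extendOfIsLattice K j := by simp
    change P (b j) = p (b j)
    rw [hj, Basis.constr_basis, Function.comp_apply]
  exact ⟨P, LinearMap.congr_fun hP⟩

section SelfDual

variable {𝒪 K V G : Type*} [CommRing 𝒪] [Field K] [Algebra 𝒪 K] [AddCommGroup V] [Module K V]
  [Module 𝒪 V] [IsScalarTower 𝒪 K V] [Group G] {ρ : Representation K G V}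

/-- The existence of a symplectic form on the `K[G]`-module `V` and of a `G`-stable lattice equal
to its own dual with respect to it. The form is not fixed in advance. -/
def HasSelfDualLattice (𝒪 : Type*) [CommRing 𝒪] [Algebra 𝒪 K] [Module 𝒪 V]
    [IsScalarTower 𝒪 K V] (ρ : Representation K G V) : Prop :=
  ∃ (f : LinearMap.BilinForm K V) (T : Submodule 𝒪 V), IsSymplecticForm ρ f ∧
    Submodule.IsLattice K T ∧ IsStable ρ T ∧ f.dualSubmodule T = T

variable [IsDomain 𝒪] [IsDiscreteValuationRing 𝒪] [IsFractionRing 𝒪 K]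

theorem eq_zero_of_forall_smul_mem {T : Submodule 𝒪 V} [Submodule.IsLattice K T] {x : V}
    (hx : ∀ c : K, c • x ∈ T) : x = 0 := by
  obtain ⟨π, hπ⟩ := IsDiscreteValuationRing.exists_irreducible 𝒪
  have hmem : (⟨x, by simpa using hx 1⟩ : T) ∈
      (⨅ i : ℕ, IsLocalRing.maximalIdeal 𝒪 ^ i • ⊤ : Submodule 𝒪 T) := by
    refine (Submodule.mem_iInf _).2 fun i => ?_
    rw [show (⟨x, _⟩ : T) = π ^ i • ⟨_, hx (algebraMap 𝒪 K (π ^ i))⁻¹⟩ from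
      Subtype.ext (smul_inv_algebraMap_smul (pow_ne_zero i hπ.ne_zero) x).symm]
    exact Submodule.smul_mem_smul (Ideal.pow_mem_pow (hπ.maximalIdeal_eq ▸
      Ideal.mem_span_singleton_self π) i) Submodule.mem_top
  rw [Ideal.iInf_pow_smul_eq_bot_of_isLocalRing _ (Ideal.IsPrime.ne_top'),
    Submodule.mem_bot] at hmem
  exact congrArg Subtype.val hmem

theorem dualSubmodule_le_of_residually_nondegenerate {f : LinearMap.BilinForm K V} {π : 𝒪}
    (hπ : Irreducible π) {T : Submodule 𝒪 V} [Submodule.IsLattice K T]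
    (h : ∀ x ∈ T, (∀ y ∈ T, ∃ a ∈ (1 : Submodule 𝒪 K), f x y = π • a) → ∃ x' ∈ T, x = π • x') :
    f.dualSubmodule T ≤ T := by
  intro x hx
  obtain ⟨m, hm⟩ := exists_pow_smul_mem K hπ T x
  induction m with
  | zero => simpa using hm
  | succ m ih =>
    apply ih
    obtain ⟨x', hx', hxx'⟩ := h _ hm fun y hy => by
      refine ⟨π ^ m • f x y, Submodule.smul_mem _ _ (hx y hy), ?_⟩
      rw [smul_smul, ← pow_succ', LinearMap.map_smul_of_tower, LinearMap.smul_apply]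
    rw [pow_succ', mul_smul] at hxx'
    rwa [lsmul_injective_of_ne_zero K hπ.ne_zero hxx']

theorem hasSelfDualLattice_of_residually_nondegenerate {f : LinearMap.BilinForm K V} {π : 𝒪}
    (hπ : Irreducible π) (halt : f.IsAlt) (hinv : ∀ (g : G) (x y : V), f (ρ g x) (ρ g y) = f x y)
    {T : Submodule 𝒪 V} (hT : IsIntegralLattice ρ f T)
    (h : ∀ x ∈ T, (∀ y ∈ T, ∃ a ∈ (1 : Submodule 𝒪 K), f x y = π • a) → ∃ x' ∈ T, x = π • x') :
    HasSelfDualLattice 𝒪 ρ := by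
  have := hT.isLattice
  have hdual := dualSubmodule_le_of_residually_nondegenerate hπ h
  refine ⟨f, T, ⟨nondegenerate_of_isAlt_of_separatingLeft halt fun x hx => ?_, halt, hinv⟩, this,
    hT.isStable, hdual.antisymm hT.le_dual⟩
  refine eq_zero_of_forall_smul_mem (T := T) fun c => hdual fun y _ => ?_
  rw [map_smul, LinearMap.smul_apply, hx y, smul_zero]
  exact zero_mem _

-- In bases of `M` and `N` adapted to each other, `p` is the projection onto the span of the basis
-- vectors which occur in `N` with a unit coefficient.
theorem exists_linearMap_mem_sub_mem_smul {M : Type*} [AddCommGroup M] [Module 𝒪 M]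
    [Module.Free 𝒪 M] [Module.Finite 𝒪 M] {π : 𝒪} (hπ : Irreducible π) (N : Submodule 𝒪 M) :
    ∃ p : M →ₗ[𝒪] M, (∀ x, p x ∈ N) ∧ ∀ t ∈ N, ∃ y, p t - t = π • y := by
  classical
  obtain ⟨n, bM, bN, φ, a, snf⟩ := Submodule.smithNormalForm (Module.finBasis 𝒪 M) N
  let p : M →ₗ[𝒪] M := bM.constr 𝒪 fun j => if ∃ i, φ i = j ∧ IsUnit (a i) then bM j else 0
  have hp : ∀ j, p (bM j) = if ∃ i, φ i = j ∧ IsUnit (a i) then bM j else 0 :=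
    bM.constr_basis 𝒪 _
  have hpM : (⊤ : Submodule 𝒪 M) ≤ N.comap p := by
    rw [← bM.span_eq, Submodule.span_le]
    rintro _ ⟨j, rfl⟩
    rw [SetLike.mem_coe, Submodule.mem_comap, hp]
    split_ifs with h
    · obtain ⟨i, rfl, hu⟩ := h
      exact (N.smul_mem_iff_of_isUnit hu).1 (snf i ▸ (bN i).2)
    · exact zero_mem _
  have hpN : (⊤ : Submodule 𝒪 N) ≤ (LinearMap.range (LinearMap.lsmul 𝒪 M π)).comap
      ((p - LinearMap.id) ∘ₗ N.subtype) := by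
    rw [← bN.span_eq, Submodule.span_le]
    rintro _ ⟨i, rfl⟩
    change p (bN i) - bN i ∈ LinearMap.range (LinearMap.lsmul 𝒪 M π)
    rw [snf i, map_smul, ← smul_sub, hp]
    split_ifs with h
    · simp
    · have hi : a i ∈ IsLocalRing.maximalIdeal 𝒪 :=
        (IsLocalRing.mem_maximalIdeal _).2 fun hu => h ⟨i, rfl, hu⟩
      rw [hπ.maximalIdeal_eq, Ideal.mem_span_singleton] at hi
      obtain ⟨c, hc⟩ := hi
      exact ⟨c • -bM (φ i), by rw [LinearMap.lsmul_apply, smul_smul, ← hc, zero_sub]⟩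
  refine ⟨p, fun x => hpM Submodule.mem_top, fun t ht => ?_⟩
  obtain ⟨y, hy⟩ := hpN (x := ⟨t, ht⟩) Submodule.mem_top
  exact ⟨y, hy.symm⟩

theorem exists_linearMap_sub_mem_smul {π : 𝒪} (hπ : Irreducible π) {T L : Submodule 𝒪 V}
    [Submodule.IsLattice K L] (hTL : T ≤ L) :
    ∃ p : V →ₗ[K] V, (∀ x ∈ L, p x ∈ T) ∧
      ∀ t ∈ T, p t - t ∈ L.map (LinearMap.lsmul 𝒪 V π) := by
  have : Module.Free 𝒪 L := Submodule.IsLattice.free K L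
  obtain ⟨p, hpL, hpT⟩ := exists_linearMap_mem_sub_mem_smul hπ (T.submoduleOf L)
  obtain ⟨P, hP⟩ := exists_linearMap_extending (K := K) (L.subtype ∘ₗ p)
  refine ⟨P, fun x hx => hP ⟨x, hx⟩ ▸ hpL ⟨x, hx⟩, fun t ht => ?_⟩
  obtain ⟨y, hy⟩ := hpT ⟨t, hTL ht⟩ ht
  exact ⟨y, y.2, by rw [hP ⟨t, hTL ht⟩]; exact congrArg Subtype.val hy.symm⟩

theorem exists_equivariant_linearMap_sub_mem_smul [Finite G] (hcard : IsUnit (Nat.card G : 𝒪))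
    {π : 𝒪} (hπ : Irreducible π) {T L : Submodule 𝒪 V} [Submodule.IsLattice K L] (hTL : T ≤ L)
    (hT : IsStable ρ T) (hL : IsStable ρ L) :
    ∃ p : V →ₗ[K] V, (∀ x ∈ L, p x ∈ T) ∧
      (∀ t ∈ T, p t - t ∈ L.map (LinearMap.lsmul 𝒪 V π)) ∧ ∀ g x, p (ρ g x) = ρ g (p x) := by
  have := Fintype.ofFinite G
  obtain ⟨p₀, hp₀T, hp₀⟩ := exists_linearMap_sub_mem_smul (K := K) hπ hTL
  have hπL : IsStable ρ (L.map (LinearMap.lsmul 𝒪 V π)) :=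
    hL.map fun g x => (LinearMap.map_smul_of_tower (ρ g) π x).symm
  obtain ⟨c, hc⟩ := hcard.exists_left_inv
  let p : V →ₗ[K] V := c • ∑ g : G, ρ g ∘ₗ p₀ ∘ₗ ρ g⁻¹
  have hp : ∀ x, p x = c • ∑ g : G, ρ g (p₀ (ρ g⁻¹ x)) := fun x => by simp [p]
  refine ⟨p, fun x hx => ?_, fun t ht => ?_, fun h x => ?_⟩
  · rw [hp]
    exact T.smul_mem _ (sum_mem fun g _ => hT g _ (hp₀T _ (hL _ _ hx)))
  · have ht_avg : t = c • ∑ g : G, ρ g (ρ g⁻¹ t) := by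
      simp only [Representation.self_inv_apply, Finset.sum_const, Finset.card_univ]
      rw [← Nat.cast_smul_eq_nsmul 𝒪, smul_smul, ← Nat.card_eq_fintype_card, hc, one_smul]
    rw [hp]
    nth_rewrite 2 [ht_avg]
    rw [← smul_sub, ← Finset.sum_sub_distrib]
    refine Submodule.smul_mem _ _ (sum_mem fun g _ => ?_)
    rw [← map_sub]
    exact hπL g _ (hp₀ _ (hT g⁻¹ t ht))
  · rw [hp, hp, LinearMap.map_smul_of_tower, map_sum]
    congr 1
    refine Fintype.sum_equiv (Equiv.mulLeft h⁻¹) _ _ fun g => ?_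
    rw [Equiv.coe_mulLeft, ← Module.End.mul_apply (ρ h), ← map_mul, mul_inv_cancel_left,
      ← Module.End.mul_apply (ρ g⁻¹), ← map_mul, mul_inv_rev, inv_inv]

end SelfDual

section AdjustedForm

variable {𝒪 K V : Type*} [CommRing 𝒪] [Field K] [Algebra 𝒪 K] [AddCommGroup V] [Module K V]

/-- The form `f (p x) (p y) + π * f (q x) (q y)`, where `q = 1 - p`. When `p` projects the dual `L`
of an integral lattice `T ⊇ π L` onto `T` modulo `π L`, it makes `L` unimodular. -/
noncomputable def adjustedForm (f : LinearMap.BilinForm K V) (p : V →ₗ[K] V) (π : 𝒪) :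
    LinearMap.BilinForm K V :=
  f.comp p p + algebraMap 𝒪 K π • f.comp (LinearMap.id - p) (LinearMap.id - p)

theorem adjustedForm_apply (f : LinearMap.BilinForm K V) (p : V →ₗ[K] V) (π : 𝒪) (x y : V) :
    adjustedForm f p π x y = f (p x) (p y) + π • f (x - p x) (y - p y) := by
  simp [adjustedForm, Algebra.smul_def]

variable [Module 𝒪 V] [IsScalarTower 𝒪 K V] {f : LinearMap.BilinForm K V} {p : V →ₗ[K] V} {π : 𝒪}
  {T L : Submodule 𝒪 V}

theorem smul_apply_mem_one (hTL : T ≤ f.dualSubmodule L) (hπL : ∀ x ∈ L, π • x ∈ T)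
    {x y : V} (hx : x ∈ L) (hy : y ∈ L) : π • f x y ∈ (1 : Submodule 𝒪 K) := by
  rw [← LinearMap.smul_apply, ← LinearMap.map_smul_of_tower]
  exact hTL (hπL x hx) y hy

theorem adjustedForm_mem_one (hTL : T ≤ L) (hTL' : T ≤ f.dualSubmodule L)
    (hπL : ∀ x ∈ L, π • x ∈ T) (hpT : ∀ x ∈ L, p x ∈ T) :
    L ≤ (adjustedForm f p π).dualSubmodule L := by
  have hqL : ∀ x ∈ L, x - p x ∈ L := fun x hx => L.sub_mem hx (hTL (hpT x hx))
  intro x hx y hy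
  rw [adjustedForm_apply]
  exact add_mem (hTL' (hpT x hx) _ (hTL (hpT y hy)))
    (smul_apply_mem_one hTL' hπL (hqL x hx) (hqL y hy))

variable [IsFractionRing 𝒪 K]

theorem exists_eq_smul_of_adjustedForm_mem (hπ : π ≠ 0) (hdualT : f.dualSubmodule T = L)
    (hTL : T ≤ L) (hTL' : T ≤ f.dualSubmodule L) (hπL : ∀ x ∈ L, π • x ∈ T)
    (hpT : ∀ x ∈ L, p x ∈ T) (hp : ∀ t ∈ T, p t - t ∈ L.map (LinearMap.lsmul 𝒪 V π))
    {x : V} (hx : x ∈ L)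
    (h : ∀ y ∈ L, ∃ a ∈ (1 : Submodule 𝒪 K), adjustedForm f p π x y = π • a) :
    ∃ x₁ ∈ L, p x = π • x₁ := by
  refine ⟨(algebraMap 𝒪 K π)⁻¹ • p x, ?_, (smul_inv_algebraMap_smul hπ _).symm⟩
  set x₁ := (algebraMap 𝒪 K π)⁻¹ • p x
  have hpx : p x = π • x₁ := (smul_inv_algebraMap_smul hπ _).symm
  rw [← hdualT]
  intro t ht
  obtain ⟨a, ha, hFa⟩ := h t (hTL ht)
  obtain ⟨l, hl, hlt⟩ := hp t ht
  have hpt : p t = t + π • l := by rw [← LinearMap.lsmul_apply π l, hlt]; abel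
  have hqt : t - p t = π • -l := by rw [hpt, smul_neg]; abel
  have hf : f x₁ t = a - f (p x) l - π • f (x - p x) (-l) := by
    apply lsmul_injective_of_ne_zero (V := K) K hπ
    rw [adjustedForm_apply, hqt, hpt, map_add, LinearMap.map_smul_of_tower,
      LinearMap.map_smul_of_tower] at hFa
    rw [LinearMap.lsmul_apply, LinearMap.lsmul_apply, smul_sub, smul_sub, ← hFa,
      ← LinearMap.smul_apply, ← LinearMap.map_smul_of_tower, ← hpx]
    abel
  rw [hf]
  exact sub_mem (sub_mem ha (hTL' (hpT x hx) l hl))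
    (smul_apply_mem_one hTL' hπL (L.sub_mem hx (hTL (hpT x hx))) (L.neg_mem hl))

theorem exists_eq_smul_of_adjustedForm_mem_smul (hπ : π ≠ 0) (hdualT : f.dualSubmodule T = L)
    (hdualL : f.dualSubmodule L = T) (hTL : T ≤ L) (hπL : ∀ x ∈ L, π • x ∈ T)
    (hpT : ∀ x ∈ L, p x ∈ T) (hp : ∀ t ∈ T, p t - t ∈ L.map (LinearMap.lsmul 𝒪 V π))
    {x : V} (hx : x ∈ L)
    (h : ∀ y ∈ L, ∃ a ∈ (1 : Submodule 𝒪 K), adjustedForm f p π x y = π • a) :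
    ∃ x' ∈ L, x = π • x' := by
  obtain ⟨x₁, hx₁, hpx⟩ :=
    exists_eq_smul_of_adjustedForm_mem hπ hdualT hTL hdualL.ge hπL hpT hp hx h
  have hqT : x - p x ∈ T := by
    rw [← hdualL]
    intro y hy
    obtain ⟨a, ha, hFa⟩ := h y hy
    have hf : f (x - p x) y = a - f x₁ (p y) + f (x - p x) (p y) := by
      apply lsmul_injective_of_ne_zero (V := K) K hπ
      rw [adjustedForm_apply, map_sub (f _) y] at hFa
      rw [LinearMap.lsmul_apply, LinearMap.lsmul_apply, smul_add, smul_sub, ← hFa,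
        ← LinearMap.smul_apply π (f x₁), ← LinearMap.map_smul_of_tower f π x₁, ← hpx, smul_sub]
      abel
    rw [hf]
    exact add_mem (sub_mem ha (hdualT.ge hx₁ _ (hpT y hy)))
      (hdualT.ge (L.sub_mem hx (hTL (hpT x hx))) _ (hpT y hy))
  have hxT : x ∈ T := by simpa using T.add_mem hqT (hpT x hx)
  obtain ⟨l, hl, hlx⟩ := hp x hxT
  refine ⟨x₁ - l, L.sub_mem hx₁ hl, ?_⟩
  rw [smul_sub, ← hpx, ← LinearMap.lsmul_apply π l, hlx]
  abel

end AdjustedForm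

theorem IsSymplecticForm.hasSelfDualLattice_of_isUnit_card {𝒪 K V G : Type*} [CommRing 𝒪]
    [IsDomain 𝒪] [IsDiscreteValuationRing 𝒪] [Field K] [Algebra 𝒪 K] [IsFractionRing 𝒪 K]
    [AddCommGroup V] [Module K V] [FiniteDimensional K V] [Module 𝒪 V] [IsScalarTower 𝒪 K V]
    [Group G] [Finite G] {ρ : Representation K G V} {f : LinearMap.BilinForm K V}
    (hf : IsSymplecticForm ρ f) (hcard : IsUnit (Nat.card G : 𝒪)) : HasSelfDualLattice 𝒪 ρ := by
  obtain ⟨f, T, hf, hT, -⟩ := hf.exists_maximal_isIntegralLattice 𝒪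
  obtain ⟨π, hπ⟩ := IsDiscreteValuationRing.exists_irreducible 𝒪
  have := hT.prop.isLattice
  have hπL := hf.uniformizer_smul_mem_of_maximal hT hπ
  have hTL := hT.prop.le_dual
  have hLstable := hf.isStable_dualSubmodule hT.prop.isStable
  have hdualL := dualSubmodule_dualSubmodule hf.nondegenerate hf.isAlt T
  have := isLattice_dualSubmodule hf.nondegenerate T
  obtain ⟨p, hpT, hp, hpρ⟩ :=
    exists_equivariant_linearMap_sub_mem_smul hcard hπ hTL hT.prop.isStable hLstable
  refine hasSelfDualLattice_of_residually_nondegenerate (f := adjustedForm f p π) hπ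
    (fun x => ?_) (fun g x y => ?_)
    ⟨this, hLstable, adjustedForm_mem_one hTL hdualL.ge hπL hpT⟩
    fun x hx => exists_eq_smul_of_adjustedForm_mem_smul hπ.ne_zero rfl hdualL hTL hπL hpT hp hx
  · rw [adjustedForm_apply, hf.isAlt.self_eq_zero, hf.isAlt.self_eq_zero, smul_zero, add_zero]
  · simp only [adjustedForm_apply, hpρ, ← map_sub, hf.invariant]

section Ramification

open Polynomial in
theorem geom_sum_X_add_one_eq {ℓ : ℕ} (hℓ : ℓ.Prime) :
    ∃ s : ℤ[X], (∑ i ∈ Finset.range ℓ, X ^ i).comp (X + 1) =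
      X ^ (ℓ - 1) + (ℓ : ℤ[X]) * (1 + X * s) := by
  obtain ⟨m, rfl⟩ := Nat.exists_eq_add_of_le' hℓ.two_le
  have hdvd : ∀ i ∈ Finset.range m, m + 2 ∣ (m + 2).choose (i + 2) := fun i hi =>
    hℓ.dvd_choose_self (by omega) (by have := Finset.mem_range.1 hi; omega)
  refine ⟨∑ i ∈ Finset.range m, (((m + 2).choose (i + 2) / (m + 2) : ℕ) : ℤ[X]) * X ^ i, ?_⟩
  rw [geom_sum_X_comp_X_add_one_eq_sum, Finset.sum_range_succ, Finset.sum_range_succ',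
    Finset.mul_sum, mul_add, Finset.mul_sum, Nat.choose_self, Nat.choose_one_right]
  have hterm : ∀ i ∈ Finset.range m, (((m + 2).choose (i + 1 + 1) : ℕ) : ℤ[X]) * X ^ (i + 1) =
      ((m + 2 : ℕ) : ℤ[X]) * (X * ((((m + 2).choose (i + 2) / (m + 2) : ℕ) : ℤ[X]) * X ^ i)) := by
    intro i hi
    rw [add_assoc, one_add_one_eq_two]
    conv_lhs => rw [← Nat.mul_div_cancel' (hdvd i hi), Nat.cast_mul]
    ring
  rw [Finset.sum_congr rfl hterm]
  simp only [show m + 2 - 1 = m + 1 from rfl]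
  ring

-- If `Φ(X + 1) = X ^ (ℓ - 1) + ℓ (1 + X s)`, then modulo `Φ(X + 1)` the ideal generated by
-- `X ^ (ℓ - 1)` contains `ℓ (1 + X s)`, and `1 + X s` is a unit modulo `X ^ (ℓ - 1)`.
open Polynomial in
theorem exists_natCast_eq_mul_geom_sum_add_mul_X_pow {ℓ : ℕ} (hℓ : ℓ.Prime) :
    ∃ c d : ℤ[X], (ℓ : ℤ[X]) =
      c * (∑ i ∈ Finset.range ℓ, X ^ i).comp (X + 1) + X ^ (ℓ - 1) * d := by
  obtain ⟨s, hs⟩ := geom_sum_X_add_one_eq hℓ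
  have hgeom := mul_neg_geom_sum (-(X * s)) (ℓ - 1)
  rw [show (-(X * s)) ^ (ℓ - 1) = X ^ (ℓ - 1) * (-s) ^ (ℓ - 1) by rw [← mul_pow]; ring] at hgeom
  refine ⟨∑ i ∈ Finset.range (ℓ - 1), (-(X * s)) ^ i,
    (ℓ : ℤ[X]) * (-s) ^ (ℓ - 1) - ∑ i ∈ Finset.range (ℓ - 1), (-(X * s)) ^ i, ?_⟩
  rw [hs]
  linear_combination (-(ℓ : ℤ[X])) * hgeom

theorem exists_natCast_eq_sub_one_pow_mul {R M : Type*} [CommRing R] [AddCommGroup M] [Module R M]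
    {ℓ : ℕ} (hℓ : ℓ.Prime) {τ : Module.End R M} (hτ : τ ^ ℓ = 1)
    (hinj : Function.Injective (τ - 1 : Module.End R M)) :
    ∃ c : Module.End R M, (ℓ : Module.End R M) = (τ - 1) ^ (ℓ - 1) * c := by
  have hgeom : ∑ i ∈ Finset.range ℓ, τ ^ i = 0 := by
    ext x
    refine hinj ?_
    rw [← Module.End.mul_apply, mul_geom_sum, hτ, sub_self, LinearMap.zero_apply,
      map_zero]
  obtain ⟨c, d, hcd⟩ := exists_natCast_eq_mul_geom_sum_add_mul_X_pow hℓ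
  refine ⟨Polynomial.aeval (τ - 1) d, ?_⟩
  simpa [Polynomial.aeval_comp, hgeom] using congrArg (Polynomial.aeval (τ - 1)) hcd

variable {𝒪 K V : Type*} [CommRing 𝒪] [AddCommGroup V] [Module 𝒪 V]

theorem map_natCast_le_map_sub_one_pow {ℓ : ℕ} (hℓ : ℓ.Prime) {L : Submodule 𝒪 V}
    {τ : Module.End 𝒪 V} (hτ : τ ^ ℓ = 1) (hL : ∀ x ∈ L, τ x ∈ L)
    (hinj : Function.Injective (τ - 1 : Module.End 𝒪 V)) :
    L.map (LinearMap.lsmul 𝒪 V (ℓ : 𝒪)) ≤ L.map ((τ - 1) ^ (ℓ - 1)) := by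
  have hL' : ∀ x ∈ L, (τ - 1) x ∈ L := fun x hx => L.sub_mem (hL x hx) hx
  have hrestrict : τ.restrict hL - 1 = (τ - 1).restrict hL' := rfl
  obtain ⟨c, hc⟩ := exists_natCast_eq_sub_one_pow_mul hℓ (τ := τ.restrict hL)
    (by ext x; simp [Module.End.pow_restrict, hτ])
    (by
      rw [hrestrict]
      exact fun x y hxy => Subtype.ext (hinj (congrArg Subtype.val hxy)))
  rw [hrestrict, Module.End.pow_restrict] at hc
  rintro _ ⟨x, hx, rfl⟩
  refine ⟨c ⟨x, hx⟩, (c ⟨x, hx⟩).2, ?_⟩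
  simpa [Nat.cast_smul_eq_nsmul] using
    (congrArg Subtype.val (LinearMap.congr_fun hc ⟨x, hx⟩)).symm

variable [Field K] [Algebra 𝒪 K] [Module K V] [IsScalarTower 𝒪 K V]
  [IsDomain 𝒪] [IsDiscreteValuationRing 𝒪] [IsFractionRing 𝒪 K]

theorem mul_relLength_le_of_pow_eq_one {ℓ e : ℕ} (hℓ : ℓ.Prime)
    (he : IsDiscreteValuationRing.addVal 𝒪 (ℓ : 𝒪) = (e : ℕ∞)) {T L : Submodule 𝒪 V}
    [Submodule.IsLattice K L] (hTL : T ≤ L) {τ : Module.End 𝒪 V} (hτ : τ ^ ℓ = 1)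
    (hL : ∀ x ∈ L, τ x ∈ L) (hinj : Function.Injective (τ - 1 : Module.End 𝒪 V))
    (hT : ∀ x ∈ L, (τ - 1) x ∈ T) :
    (ℓ - 1 : ℕ) * relLength T L ≤ e * finrank K V := by
  have hLT : L.map (τ - 1) ≤ T := Submodule.map_le_iff_le_comap.2 hT
  have hLL := hLT.trans hTL
  calc (ℓ - 1 : ℕ) * relLength T L ≤ (ℓ - 1 : ℕ) * relLength (L.map (τ - 1)) L := by
        gcongr
        exact relLength_anti hLT hTL
    _ = relLength (L.map ((τ - 1) ^ (ℓ - 1))) L := (relLength_map_pow hinj hLL (ℓ - 1)).symm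
    _ ≤ relLength (L.map (LinearMap.lsmul 𝒪 V (ℓ : 𝒪))) L :=
        relLength_anti (map_natCast_le_map_sub_one_pow hℓ hτ hL hinj) (map_pow_le hLL _)
    _ = _ := relLength_map_of_addVal (K := K) he L

end Ramification

section Discriminant

theorem exists_span_singleton_sup_eq_of_relLength_eq_one {R V : Type*} [CommRing R]
    [AddCommGroup V] [Module R V] {T L : Submodule R V} (hTL : T ≤ L) (h : relLength T L = 1) :
    ∃ x, Submodule.span R {x} ⊔ T = L := by
  have : IsSimpleModule R (L ⧸ T.submoduleOf L) := Module.length_eq_one_iff.1 h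
  have := IsSimpleModule.nontrivial R (L ⧸ T.submoduleOf L)
  obtain ⟨q, hq⟩ := exists_ne (0 : L ⧸ T.submoduleOf L)
  obtain ⟨x, rfl⟩ := Submodule.Quotient.mk_surjective _ q
  refine ⟨x, le_antisymm (sup_le ((Submodule.span_singleton_le_iff_mem _ _).2 x.2) hTL)
    fun y hy => ?_⟩
  obtain ⟨c, hc⟩ := Submodule.mem_span_singleton.1 (IsSimpleModule.span_singleton_eq_top R hq ▸
    Submodule.mem_top : Submodule.Quotient.mk (⟨y, hy⟩ : L) ∈ Submodule.span R _)
  rw [← Submodule.Quotient.mk_smul, eq_comm, Submodule.Quotient.eq] at hc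
  exact Submodule.mem_sup.2 ⟨_, Submodule.smul_mem _ c (Submodule.mem_span_singleton_self _), _, hc,
    by simp⟩

-- The discriminant `L / T` carries a perfect alternating form with values in `K / 𝒪`, so that it
-- cannot be generated by a single nonzero element.
theorem two_le_relLength_dualSubmodule {𝒪 K V : Type*} [CommRing 𝒪] [Field K] [Algebra 𝒪 K]
    [AddCommGroup V] [Module K V] [Module 𝒪 V] [IsScalarTower 𝒪 K V] [IsDomain 𝒪]
    [IsDiscreteValuationRing 𝒪] [IsFractionRing 𝒪 K] {f : LinearMap.BilinForm K V}
    (hf : f.Nondegenerate) (halt : f.IsAlt) {T : Submodule 𝒪 V} [Submodule.IsLattice K T]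
    (hT : T ≤ f.dualSubmodule T) (hne : f.dualSubmodule T ≠ T) :
    2 ≤ relLength T (f.dualSubmodule T) := by
  have h0 : relLength T (f.dualSubmodule T) ≠ 0 := fun h =>
    hne ((relLength_eq_zero_iff.1 h).antisymm hT)
  by_contra hlt
  have h1 : relLength T (f.dualSubmodule T) = 1 :=
    le_antisymm (Order.le_of_lt_add_one (by rw [one_add_one_eq_two]; exact not_le.1 hlt))
      (Order.one_le_iff_ne_zero.2 h0)
  obtain ⟨x, hx⟩ := exists_span_singleton_sup_eq_of_relLength_eq_one hT h1
  have hxL : Submodule.span 𝒪 {x} ≤ f.dualSubmodule T := le_sup_left.trans hx.le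
  have hxx : Submodule.span 𝒪 {x} ≤ f.dualSubmodule (Submodule.span 𝒪 {x}) := by
    rw [Submodule.span_singleton_le_iff_mem]
    intro y hy
    obtain ⟨c, rfl⟩ := Submodule.mem_span_singleton.1 hy
    rw [LinearMap.map_smul_of_tower, halt.self_eq_zero, smul_zero]
    exact zero_mem _
  refine hne (le_antisymm ?_ hT)
  calc f.dualSubmodule T = Submodule.span 𝒪 {x} ⊔ T := hx.symm
    _ ≤ f.dualSubmodule (Submodule.span 𝒪 {x}) ⊓ f.dualSubmodule T :=
        sup_le (le_inf hxx hxL) (le_inf ((le_dualSubmodule_comm halt).1 hxL) hT)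
    _ = f.dualSubmodule (f.dualSubmodule T) := by rw [← dualSubmodule_sup, hx]
    _ = T := dualSubmodule_dualSubmodule hf halt T

end Discriminant

section LocalRing

variable {𝒪 : Type*} [CommRing 𝒪] [IsLocalRing 𝒪] {ℓ : ℕ} [CharP (IsLocalRing.ResidueField 𝒪) ℓ]

theorem natCast_mem_maximalIdeal_iff {n : ℕ} : (n : 𝒪) ∈ IsLocalRing.maximalIdeal 𝒪 ↔ ℓ ∣ n := by
  rw [← IsLocalRing.residue_eq_zero_iff, map_natCast, CharP.cast_eq_zero_iff _ ℓ]

theorem isUnit_natCast_iff {n : ℕ} : IsUnit (n : 𝒪) ↔ ¬ ℓ ∣ n := by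
  rw [← natCast_mem_maximalIdeal_iff (𝒪 := 𝒪), IsLocalRing.mem_maximalIdeal, mem_nonunits_iff,
    not_not]

end LocalRing

section DiscriminantAction

theorem exists_sub_one_pow_eq_natCast_mul {A : Type*} [Ring A] {ℓ : ℕ} (hℓ : ℓ.Prime) {a : A}
    (ha : a ^ ℓ = 1) : ∃ r, (a - 1) ^ ℓ = ℓ * r := by
  obtain ⟨r, hr⟩ := (Commute.one_right (a - 1)).exists_add_pow_prime_eq hℓ
  rw [sub_add_cancel, ha, one_pow, mul_one, mul_assoc, add_right_comm, right_eq_add] at hr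
  exact ⟨-((a - 1) * r), by rw [mul_neg]; exact eq_neg_of_add_eq_zero_left hr⟩

theorem exists_sub_one_pow_apply_eq_natCast_smul {R M : Type*} [CommRing R] [AddCommGroup M]
    [Module R M] {ℓ : ℕ} (hℓ : ℓ.Prime) {L : Submodule R M} {τ : Module.End R M} (hτ : τ ^ ℓ = 1)
    (hL : ∀ x ∈ L, τ x ∈ L) {x : M} (hx : x ∈ L) :
    ∃ y ∈ L, ((τ - 1) ^ ℓ) x = (ℓ : R) • y := by
  have hL' : ∀ x ∈ L, (τ - 1) x ∈ L := fun x hx => L.sub_mem (hL x hx) hx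
  obtain ⟨r, hr⟩ := exists_sub_one_pow_eq_natCast_mul hℓ (a := τ.restrict hL)
    (by ext x; simp [Module.End.pow_restrict, hτ])
  rw [show τ.restrict hL - 1 = (τ - 1).restrict hL' from rfl, Module.End.pow_restrict] at hr
  refine ⟨r ⟨x, hx⟩, (r ⟨x, hx⟩).2, ?_⟩
  simpa [Nat.cast_smul_eq_nsmul] using congrArg Subtype.val (LinearMap.congr_fun hr ⟨x, hx⟩)

variable {𝒪 K V G : Type*} [Field K] [AddCommGroup V] [Module K V] [Group G]
  {ρ : Representation K G V}

section

variable [CommRing 𝒪] [Algebra 𝒪 K] [Module 𝒪 V] [IsScalarTower 𝒪 K V]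

/-- The `K`-linear action `ρ` as an action by `𝒪`-linear maps. -/
def restrictScalarsRepresentation (𝒪 : Type*) [CommRing 𝒪] [Algebra 𝒪 K] [Module 𝒪 V]
    [IsScalarTower 𝒪 K V] (ρ : Representation K G V) : Representation 𝒪 G V where
  toFun g := (ρ g).restrictScalars 𝒪
  map_one' := by ext; simp
  map_mul' g h := by ext; simp

/-- The action of `G` on `L / T` for stable `𝒪`-submodules `T` and `L` of a representation over
`K`. -/
def quotientRepresentation {T L : Submodule 𝒪 V} (hT : IsStable ρ T) (hL : IsStable ρ L) :
    Representation 𝒪 G (L ⧸ T.submoduleOf L) :=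
  ((restrictScalarsRepresentation 𝒪 ρ).subrepresentation L hL).quotient _ fun g x hx => hT g x hx

theorem quotientRepresentation_eq_one_iff {T L : Submodule 𝒪 V} {hT : IsStable ρ T}
    {hL : IsStable ρ L} {g : G} :
    quotientRepresentation hT hL g = 1 ↔ ∀ x ∈ L, ρ g x - x ∈ T := by
  constructor
  · intro h x hx
    exact (Submodule.Quotient.eq (T.submoduleOf L)).1
      (LinearMap.congr_fun h (Submodule.Quotient.mk ⟨x, hx⟩))
  · intro h
    ext x
    exact (Submodule.Quotient.eq (T.submoduleOf L)).2 (h x x.2)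

end

variable [CommRing 𝒪] [IsDomain 𝒪] [IsDiscreteValuationRing 𝒪] [Algebra 𝒪 K] [IsFractionRing 𝒪 K]
  [Module 𝒪 V] [IsScalarTower 𝒪 K V] [FiniteDimensional K V] {f : LinearMap.BilinForm K V}
  {T : Submodule 𝒪 V}

namespace IsSymplecticForm

theorem smul_mem_of_maximal (hf : IsSymplecticForm ρ f) (hT : Maximal (IsIntegralLattice ρ f) T)
    {r : 𝒪} (hr : r ∈ IsLocalRing.maximalIdeal 𝒪) : ∀ x ∈ f.dualSubmodule T, r • x ∈ T := by
  obtain ⟨π, hπ⟩ := IsDiscreteValuationRing.exists_irreducible 𝒪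
  rw [hπ.maximalIdeal_eq, Ideal.mem_span_singleton'] at hr
  obtain ⟨c, rfl⟩ := hr
  exact fun x hx => mul_smul c π x ▸
    T.smul_mem c (hf.uniformizer_smul_mem_of_maximal hT hπ x hx)

theorem apply_sub_mem_of_mem_center (hf : IsSymplecticForm ρ f)
    (hT : Maximal (IsIntegralLattice ρ f) T) {ℓ : ℕ} (hℓ : ℓ.Prime)
    [CharP (IsLocalRing.ResidueField 𝒪) ℓ] {τ : G} (hτ : τ ∈ Subgroup.center G)
    (hτℓ : τ ^ ℓ = 1) : ∀ x ∈ f.dualSubmodule T, ρ τ x - x ∈ T := by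
  have hpow : restrictScalarsRepresentation 𝒪 ρ τ ^ ℓ = 1 := by rw [← map_pow, hτℓ, map_one]
  obtain ⟨m, rfl⟩ := Nat.exists_eq_add_of_le' hℓ.one_le
  refine hf.apply_mem_of_maximal hT (D := restrictScalarsRepresentation 𝒪 ρ τ - 1)
    (U := -restrictScalarsRepresentation 𝒪 ρ τ⁻¹) (m := m) (fun g x => ?_) (fun x y => ?_)
    (fun x hx => T.sub_mem (hT.prop.isStable τ x hx) hx)
    (fun x hx => T.neg_mem (hT.prop.isStable τ⁻¹ x hx)) fun x hx => ?_
  · simp [restrictScalarsRepresentation, ← Module.End.mul_apply, ← map_mul,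
      Subgroup.mem_center_iff.1 hτ g]
  · simp [restrictScalarsRepresentation, hf.apply_left]
  · obtain ⟨y, hy, h⟩ := exists_sub_one_pow_apply_eq_natCast_smul hℓ hpow
      (hf.isStable_dualSubmodule hT.prop.isStable τ) hx
    rw [h]
    exact hf.smul_mem_of_maximal hT (natCast_mem_maximalIdeal_iff.2 dvd_rfl) y hy

end IsSymplecticForm

end DiscriminantAction

section Indecomposable

variable {K V G : Type*} [Field K] [AddCommGroup V] [Module K V] [Group G]
  {ρ : Representation K G V} {f : LinearMap.BilinForm K V}

theorem IsSymplecticForm.restrict_invariants_nondegenerate [CharZero K]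
    (hf : IsSymplecticForm ρ f) (N : Subgroup G) [Finite N] :
    (f.restrict (Representation.invariants (ρ.comp N.subtype))).Nondegenerate := by
  have := Fintype.ofFinite N
  refine nondegenerate_of_isAlt_of_separatingLeft (fun x => hf.isAlt x.1) fun x hx =>
    Subtype.ext (hf.nondegenerate.1 x.1 fun y => ?_)
  let z : V := Representation.norm (ρ.comp N.subtype) y
  have hxz : f x z = 0 := hx ⟨z, fun g => Representation.self_norm_apply _ g y⟩
  have hsum : f x z = (Fintype.card N : K) * f x y := by
    have hfx : ∀ h : N, f x (ρ h y) = f x y := fun h => by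
      conv_lhs => rw [← x.2 h]
      exact hf.invariant _ _ _
    simp [z, Representation.norm, hfx]
  exact (mul_eq_zero.1 (hsum ▸ hxz)).resolve_left (by simp)

/-- For every symplectic structure, `V` is not an orthogonal sum of two nonzero
subrepresentations. -/
def IsSymplecticallyIndecomposable (ρ : Representation K G V) : Prop :=
  ∀ (f : LinearMap.BilinForm K V) (W : Submodule K V), IsSymplecticForm ρ f → IsStable ρ W →
    (f.restrict W).Nondegenerate → W = ⊥ ∨ W = ⊤

theorem IsSymplecticallyIndecomposable.apply_eq_one [CharZero K]
    (hρ : IsSymplecticallyIndecomposable ρ) (hf : IsSymplecticForm ρ f) {N : Subgroup G} [N.Normal]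
    [Finite N] (hN : (Representation.invariants (ρ.comp N.subtype)) ≠ ⊥) {h : G} (hh : h ∈ N) :
    ρ h = 1 := by
  have htop := (hρ f _ hf (ρ.le_comap_invariants N)
    (hf.restrict_invariants_nondegenerate N)).resolve_left hN
  ext v
  exact (htop ▸ Submodule.mem_top : v ∈ Representation.invariants (ρ.comp N.subtype)) ⟨h, hh⟩

theorem invariants_ne_bot_of_sub_mem {𝒪 : Type*} [CommRing 𝒪] [Module 𝒪 V] {T L : Submodule 𝒪 V}
    (hLT : ¬ L ≤ T) {N : Subgroup G} [Finite N] (hN : IsUnit (Nat.card N : 𝒪))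
    (htriv : ∀ h ∈ N, ∀ x ∈ L, ρ h x - x ∈ T) :
    Representation.invariants (ρ.comp N.subtype) ≠ ⊥ := by
  have := Fintype.ofFinite N
  obtain ⟨x, hxL, hxT⟩ := SetLike.not_le_iff_exists.1 hLT
  let z : V := Representation.norm (ρ.comp N.subtype) x
  have hz : z ∈ Representation.invariants (ρ.comp N.subtype) :=
    fun g => Representation.self_norm_apply _ g x
  have hzx : z - (Nat.card N : 𝒪) • x ∈ T := by
    have hsum : ∑ h : N, (ρ h x - x) ∈ T := sum_mem fun h _ => htriv h h.2 x hxL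
    simpa [z, Representation.norm, Nat.cast_smul_eq_nsmul] using hsum
  intro hbot
  rw [hbot, Submodule.mem_bot] at hz
  rw [hz, zero_sub, neg_mem_iff] at hzx
  exact hxT ((Submodule.smul_mem_iff_of_isUnit T hN).1 hzx)

theorem IsSymplecticallyIndecomposable.injective_apply_sub_one [CharZero K] [Finite G]
    (hρ : IsSymplecticallyIndecomposable ρ) (hf : IsSymplecticForm ρ f) {τ : G}
    (hτ : τ ∈ Subgroup.center G) (hτ1 : ρ τ ≠ 1) :
    Function.Injective (ρ τ - 1 : Module.End K V) := by
  have : (Subgroup.zpowers τ).Normal :=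
    ⟨fun n hn g => by
      rwa [Subgroup.mem_center_iff.1 (Subgroup.zpowers_le.2 hτ hn) g, mul_inv_cancel_right]⟩
  have hgen (y : Subgroup.zpowers τ) :
      y ∈ Subgroup.zpowers (⟨τ, Subgroup.mem_zpowers τ⟩ : Subgroup.zpowers τ) := by
    obtain ⟨_, i, rfl⟩ := y
    exact ⟨i, rfl⟩
  rw [← LinearMap.ker_eq_bot]
  by_contra hbot
  refine hτ1 (hρ.apply_eq_one hf (N := Subgroup.zpowers τ) (fun h => hbot ?_)
    (Subgroup.mem_zpowers τ))
  rw [eq_bot_iff, ← h]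
  intro x hx
  rw [Representation.mem_invariants_iff_of_forall_mem_zpowers _ _ hgen]
  exact sub_eq_zero.1 hx

end Indecomposable

section CentralElement

variable {G : Type*} [Group G] {H : Subgroup G} [H.Normal]

theorem exists_forall_eq_zpow_mul [IsCyclic (G ⧸ H)] :
    ∃ g₀ : G, (∀ g : G, ∃ (i : ℤ) (h : G), h ∈ H ∧ g = g₀ ^ i * h) ∧
      Nat.card (G ⧸ H) ∣ orderOf g₀ := by
  obtain ⟨q, hq⟩ := IsCyclic.exists_generator (α := G ⧸ H)
  obtain ⟨g₀, rfl⟩ := QuotientGroup.mk_surjective q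
  refine ⟨g₀, fun g => ?_, ?_⟩
  · obtain ⟨i, hi⟩ := Subgroup.mem_zpowers_iff.1 (hq g)
    exact ⟨i, (g₀ ^ i)⁻¹ * g, QuotientGroup.eq.1 hi, by group⟩
  · rw [← orderOf_eq_card_of_forall_mem_zpowers hq]
    exact orderOf_map_dvd (QuotientGroup.mk' H) g₀

theorem exists_mem_center_orderOf_eq [Finite G] [IsCyclic (G ⧸ H)] {ℓ : ℕ} (hℓ : ℓ.Prime)
    (hH : ¬ ℓ ∣ Nat.card H) (hG : ℓ ∣ Nat.card G)
    (hcomm : ∀ g, g ^ ℓ = 1 → ∀ h ∈ H, Commute g h) :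
    ∃ τ ∈ Subgroup.center G, orderOf τ = ℓ := by
  obtain ⟨g₀, hg₀, hcard⟩ := exists_forall_eq_zpow_mul (H := H)
  rw [Subgroup.card_eq_card_quotient_mul_card_subgroup H] at hG
  have hdvd : ℓ ∣ orderOf g₀ := ((hℓ.dvd_mul.1 hG).resolve_right hH).trans hcard
  have horder : orderOf (g₀ ^ (orderOf g₀ / ℓ)) = ℓ :=
    orderOf_pow_orderOf_div (orderOf_pos g₀).ne' hdvd
  refine ⟨_, Subgroup.mem_center_iff.2 fun g => ?_, horder⟩
  obtain ⟨i, h, hh, rfl⟩ := hg₀ g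
  exact ((((Commute.refl g₀).pow_left _).zpow_right i).mul_right
    (hcomm _ (orderOf_dvd_iff_pow_eq_one.1 horder.dvd) h hh)).eq.symm

end CentralElement

section FaithfulCase

variable {𝒪 K V G : Type*} [CommRing 𝒪] [IsDomain 𝒪] [IsDiscreteValuationRing 𝒪] [Field K]
  [Algebra 𝒪 K] [IsFractionRing 𝒪 K] [AddCommGroup V] [Module K V] [FiniteDimensional K V]
  [Module 𝒪 V] [IsScalarTower 𝒪 K V] [Group G] {ρ : Representation K G V}
  {f : LinearMap.BilinForm K V} {T : Submodule 𝒪 V}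

theorem dualSubmodule_eq_of_mem_center (hf : IsSymplecticForm ρ f)
    (hT : Maximal (IsIntegralLattice ρ f) T) {ℓ e : ℕ} (hℓ : ℓ.Prime)
    [CharP (IsLocalRing.ResidueField 𝒪) ℓ]
    (he : IsDiscreteValuationRing.addVal 𝒪 (ℓ : 𝒪) = (e : ℕ∞))
    (hdim : finrank K V * e < 2 * (ℓ - 1)) {τ : G} (hτ : τ ∈ Subgroup.center G) (hτℓ : τ ^ ℓ = 1)
    (hinj : Function.Injective (ρ τ - 1 : Module.End K V)) : f.dualSubmodule T = T := by
  by_contra hne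
  have := hT.prop.isLattice
  have := isLattice_dualSubmodule hf.nondegenerate T
  have hpow : restrictScalarsRepresentation 𝒪 ρ τ ^ ℓ = 1 := by rw [← map_pow, hτℓ, map_one]
  have hupper := mul_relLength_le_of_pow_eq_one (K := K) hℓ he hT.prop.le_dual hpow
    (hf.isStable_dualSubmodule hT.prop.isStable τ) hinj
    (hf.apply_sub_mem_of_mem_center hT hℓ hτ hτℓ)
  have hlower := two_le_relLength_dualSubmodule hf.nondegenerate hf.isAlt hT.prop.le_dual hne
  grw [← hlower] at hupper
  norm_cast at hupper
  lia

variable [CharZero K]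

theorem IsSymplecticallyIndecomposable.commute_of_maximal
    (hρ : IsSymplecticallyIndecomposable ρ) (hinj : Function.Injective ρ)
    (hf : IsSymplecticForm ρ f) (hT : Maximal (IsIntegralLattice ρ f) T)
    (hne : ¬ f.dualSubmodule T ≤ T) {ℓ s : ℕ} [Fact ℓ.Prime]
    [CharP (IsLocalRing.ResidueField 𝒪) ℓ] (hlen : relLength T (f.dualSubmodule T) + 1 < ℓ)
    {H : Subgroup G} [H.Normal] [Finite H] [Group.IsSolvable H] (hH : IsUnit (Nat.card H : 𝒪))
    {g h : G} (hg : g ^ ℓ ^ s = 1) (hh : h ∈ H) : Commute g h := by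
  have := hT.prop.isLattice
  have := isLattice_dualSubmodule hf.nondegenerate T
  have : Module.Finite 𝒪 (f.dualSubmodule T) :=
    Module.Finite.of_fg (Submodule.IsLattice.fg (A := K))
  let θ := quotientRepresentation hT.prop.isStable (hf.isStable_dualSubmodule hT.prop.isStable)
  have htorsion : ∀ r ∈ IsLocalRing.maximalIdeal 𝒪,
      ∀ x : f.dualSubmodule T ⧸ T.submoduleOf (f.dualSubmodule T), r • x = 0 := by
    rintro r hr ⟨x⟩
    exact (Submodule.Quotient.mk_eq_zero _).2 (hf.smul_mem_of_maximal hT hr x x.2)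
  have hθ : Commute (θ g) (θ h) := commute_apply_of_length_add_one_lt htorsion θ hlen hH hg hh
  let N := H ⊓ θ.ker
  have hN : IsUnit (Nat.card N : 𝒪) :=
    isUnit_of_dvd_unit (Nat.cast_dvd_cast (Subgroup.card_dvd_of_le inf_le_left)) hH
  have : Finite N := Finite.of_injective _ (Subgroup.inclusion_injective inf_le_left)
  have hNρ {n : G} (hn : n ∈ N) : ρ n = 1 := hρ.apply_eq_one hf
    (invariants_ne_bot_of_sub_mem hne hN fun h hh => quotientRepresentation_eq_one_iff.1 hh.2) hn
  refine commutatorElement_eq_one_iff_commute.1 (hinj ((hNρ ⟨?_, ?_⟩).trans (map_one ρ).symm))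
  · exact H.mul_mem (Subgroup.Normal.conj_mem ‹_› h hh g) (H.inv_mem hh)
  · exact map_commutatorElement_eq_one hθ

theorem IsSymplecticallyIndecomposable.hasSelfDualLattice_of_injective [Finite G]
    (hρ : IsSymplecticallyIndecomposable ρ) (hinj : Function.Injective ρ)
    (hf : IsSymplecticForm ρ f) {ℓ e : ℕ} (hℓ : ℓ.Prime) [CharP (IsLocalRing.ResidueField 𝒪) ℓ]
    (he : IsDiscreteValuationRing.addVal 𝒪 (ℓ : 𝒪) = (e : ℕ∞))
    (hdim : finrank K V * e < 2 * (ℓ - 1)) {H : Subgroup G} [H.Normal] [Group.IsSolvable H]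
    [IsCyclic (G ⧸ H)] (hH : ¬ ℓ ∣ Nat.card H) : HasSelfDualLattice 𝒪 ρ := by
  by_cases hG : ℓ ∣ Nat.card G
  swap
  · exact hf.hasSelfDualLattice_of_isUnit_card (isUnit_natCast_iff.2 hG)
  obtain ⟨f', T, hf', hT, hlen⟩ := hf.exists_maximal_isIntegralLattice 𝒪
  refine ⟨f', T, hf', hT.prop.isLattice, hT.prop.isStable, ?_⟩
  by_contra hne
  have he0 : e ≠ 0 := by
    rintro rfl
    exact isUnit_natCast_iff.1 (IsDiscreteValuationRing.addVal_eq_zero_iff.1 he) dvd_rfl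
  have hlen' : relLength T (f'.dualSubmodule T) + 1 < ℓ := by
    have := hT.prop.isLattice
    have := isLattice_dualSubmodule hf'.nondegenerate T
    lift relLength T (f'.dualSubmodule T) to ℕ
      using relLength_ne_top (K := K) hT.prop.le_dual with r
    norm_cast at hlen ⊢
    have := Nat.le_mul_of_pos_right (finrank K V) (Nat.pos_of_ne_zero he0)
    lia
  have := Fact.mk hℓ
  obtain ⟨τ, hτ, horder⟩ := exists_mem_center_orderOf_eq hℓ hH hG fun g hg h hh =>
    hρ.commute_of_maximal (s := 1) hinj hf' hT (fun h => hne (h.antisymm hT.prop.le_dual)) hlen'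
      (isUnit_natCast_iff.2 hH) (by rwa [pow_one]) hh
  refine hne (dualSubmodule_eq_of_mem_center hf' hT hℓ he hdim hτ
    (orderOf_dvd_iff_pow_eq_one.1 horder.dvd) (hρ.injective_apply_sub_one hf' hτ fun h => ?_))
  exact hℓ.ne_one (horder ▸ orderOf_eq_one_iff.2 (hinj (h.trans (map_one ρ).symm)))

end FaithfulCase

section Inflation

variable {𝒪 K V G Γ : Type*} [CommRing 𝒪] [Field K] [AddCommGroup V] [Module K V] [Group G]
  [Group Γ] {ρ : Representation K Γ V} {f : LinearMap.BilinForm K V} {φ : G →* Γ}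

theorem isStable_comp_iff [Module 𝒪 V] (hφ : Function.Surjective φ) {T : Submodule 𝒪 V} :
    IsStable (ρ.comp φ) T ↔ IsStable ρ T :=
  (hφ.forall (p := fun g => ∀ x ∈ T, ρ g x ∈ T)).symm

theorem isSymplecticForm_comp_iff (hφ : Function.Surjective φ) :
    IsSymplecticForm (ρ.comp φ) f ↔ IsSymplecticForm ρ f :=
  ⟨fun h => ⟨h.nondegenerate, h.isAlt, hφ.forall.2 h.invariant⟩,
    fun h => ⟨h.nondegenerate, h.isAlt, fun g => h.invariant (φ g)⟩⟩

theorem isSymplecticallyIndecomposable_comp_iff (hφ : Function.Surjective φ) :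
    IsSymplecticallyIndecomposable (ρ.comp φ) ↔ IsSymplecticallyIndecomposable ρ := by
  simp only [IsSymplecticallyIndecomposable, isSymplecticForm_comp_iff hφ, isStable_comp_iff hφ]

theorem hasSelfDualLattice_comp_iff [Algebra 𝒪 K] [Module 𝒪 V] [IsScalarTower 𝒪 K V]
    (hφ : Function.Surjective φ) :
    HasSelfDualLattice 𝒪 (ρ.comp φ) ↔ HasSelfDualLattice 𝒪 ρ := by
  simp only [HasSelfDualLattice, isSymplecticForm_comp_iff hφ, isStable_comp_iff hφ]

theorem IsSymplecticallyIndecomposable.hasSelfDualLattice [IsDomain 𝒪]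
    [IsDiscreteValuationRing 𝒪] [Algebra 𝒪 K] [IsFractionRing 𝒪 K] [CharZero K]
    [FiniteDimensional K V] [Module 𝒪 V] [IsScalarTower 𝒪 K V] [Finite G]
    {ρ : Representation K G V} (hρ : IsSymplecticallyIndecomposable ρ) (hf : IsSymplecticForm ρ f)
    {ℓ e : ℕ} (hℓ : ℓ.Prime) [CharP (IsLocalRing.ResidueField 𝒪) ℓ]
    (he : IsDiscreteValuationRing.addVal 𝒪 (ℓ : 𝒪) = (e : ℕ∞))
    (hdim : finrank K V * e < 2 * (ℓ - 1)) {H : Subgroup G} [H.Normal] [Group.IsSolvable H]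
    [IsCyclic (G ⧸ H)] (hH : ¬ ℓ ∣ Nat.card H) : HasSelfDualLattice 𝒪 ρ := by
  let φ := QuotientGroup.mk' ρ.ker
  let ρ' : Representation K (G ⧸ ρ.ker) V := QuotientGroup.lift ρ.ker ρ le_rfl
  have hφ : Function.Surjective φ := QuotientGroup.mk'_surjective _
  have hφH := φ.subgroupMap_surjective H
  have hinj : Function.Injective ρ' := (injective_iff_map_eq_one _).2 <|
    hφ.forall.2 fun g hg => (QuotientGroup.eq_one_iff g).2 hg
  have : (H.map φ).Normal := Subgroup.Normal.map ‹_› φ hφ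
  have : Group.IsSolvable (H.map φ) := Group.isSolvable_of_surjective hφH
  have : IsCyclic ((G ⧸ ρ.ker) ⧸ H.map φ) := isCyclic_of_surjective
    (QuotientGroup.map H (H.map φ) φ (Subgroup.le_comap_map φ H))
    (QuotientGroup.map_surjective_of_surjective _ _ _ ((QuotientGroup.mk'_surjective _).comp hφ) _)
  refine (hasSelfDualLattice_comp_iff (ρ := ρ') hφ).2 ?_
  exact ((isSymplecticallyIndecomposable_comp_iff hφ).1 hρ).hasSelfDualLattice_of_injective hinj
    ((isSymplecticForm_comp_iff hφ).1 hf) hℓ he hdim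
    (mt (fun h => h.trans (Subgroup.card_dvd_of_surjective _ hφH)) hH)

end Inflation

section Splitting

variable {𝒪 K V W G : Type*} [CommRing 𝒪] [Field K] [Algebra 𝒪 K] [AddCommGroup V] [Module K V]
  [Module 𝒪 V] [IsScalarTower 𝒪 K V] [AddCommGroup W] [Module K W] [Module 𝒪 W]
  [IsScalarTower 𝒪 K W] [Group G] {ρ : Representation K G V} {σ : Representation K G W}

theorem isLattice_prod (T : Submodule 𝒪 V) (U : Submodule 𝒪 W) [Submodule.IsLattice K T]
    [Submodule.IsLattice K U] : Submodule.IsLattice K (T.prod U) where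
  fg := (Submodule.IsLattice.fg (A := K)).prod (Submodule.IsLattice.fg (A := K))
  span_eq_top := top_le_iff.1 <| calc
    ⊤ = (Submodule.span K (T : Set V)).prod (Submodule.span K (U : Set W)) := by
      rw [Submodule.IsLattice.span_eq_top, Submodule.IsLattice.span_eq_top, Submodule.prod_top]
    _ = Submodule.span K (LinearMap.inl K V W '' T ∪ LinearMap.inr K V W '' U) :=
      LinearMap.span_inl_union_inr.symm
    _ ≤ Submodule.span K (T.prod U : Set (V × W)) := Submodule.span_mono <| by
      rintro _ (⟨t, ht, rfl⟩ | ⟨u, hu, rfl⟩)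
      exacts [⟨ht, U.zero_mem⟩, ⟨T.zero_mem, hu⟩]

theorem isLattice_map (φ : V ≃ₗ[K] W) (T : Submodule 𝒪 V) [Submodule.IsLattice K T] :
    Submodule.IsLattice K (T.map (φ.restrictScalars 𝒪 : V →ₗ[𝒪] W)) where
  fg := (Submodule.IsLattice.fg (A := K)).map _
  span_eq_top := by
    have himage : (T.map (φ.restrictScalars 𝒪 : V →ₗ[𝒪] W) : Set W) = φ.toLinearMap '' T := rfl
    rw [himage, Submodule.span_image, Submodule.IsLattice.span_eq_top, Submodule.map_top,
      LinearEquiv.range]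

theorem HasSelfDualLattice.prod (hρ : HasSelfDualLattice 𝒪 ρ) (hσ : HasSelfDualLattice 𝒪 σ) :
    HasSelfDualLattice 𝒪 (ρ.prod σ) := by
  obtain ⟨f, T, hf, hT, hTρ, hTf⟩ := hρ
  obtain ⟨f', T', hf', hT', hTσ, hTf'⟩ := hσ
  let F : LinearMap.BilinForm K (V × W) :=
    f.compl₁₂ (.fst K V W) (.fst K V W) + f'.compl₁₂ (.snd K V W) (.snd K V W)
  have hF (x y) : F x y = f x.1 y.1 + f' x.2 y.2 := rfl
  have halt : F.IsAlt := fun x => by rw [hF, hf.isAlt, hf'.isAlt, add_zero]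
  have hFl (x v) : F x (v, 0) = f x.1 v := by simp [hF]
  have hFr (x w) : F x (0, w) = f' x.2 w := by simp [hF]
  refine ⟨F, T.prod T', ⟨nondegenerate_of_isAlt_of_separatingLeft halt fun x hx => ?_, halt,
    fun g x y => ?_⟩, isLattice_prod T T', fun g x hx => ⟨hTρ g _ hx.1, hTσ g _ hx.2⟩,
    le_antisymm (fun x hx => ?_) fun x hx y hy => ?_⟩
  · exact Prod.ext (hf.nondegenerate.1 _ fun v => hFl x v ▸ hx _)
      (hf'.nondegenerate.1 _ fun w => hFr x w ▸ hx _)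
  · exact congrArg₂ (· + ·) (hf.invariant g _ _) (hf'.invariant g _ _)
  · rw [← hTf, ← hTf']
    exact ⟨fun t ht => hFl x t ▸ hx _ ⟨ht, T'.zero_mem⟩,
      fun t ht => hFr x t ▸ hx _ ⟨T.zero_mem, ht⟩⟩
  · exact add_mem (hTf.ge hx.1 _ hy.1) (hTf'.ge hx.2 _ hy.2)

theorem HasSelfDualLattice.of_equiv (φ : Representation.Equiv ρ σ)
    (hρ : HasSelfDualLattice 𝒪 ρ) : HasSelfDualLattice 𝒪 σ := by
  obtain ⟨f, T, hf, hT, hTρ, hTf⟩ := hρ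
  let ψ : W ≃ₗ[K] V := φ.toLinearEquiv.symm
  have hψ (g w) : ψ (σ g w) = ρ g (ψ w) := LinearMap.congr_fun (φ.symm.isIntertwining' g) w
  let S : Submodule 𝒪 W := T.map (φ.toLinearEquiv.restrictScalars 𝒪 : V →ₗ[𝒪] W)
  have mem_S {w} : w ∈ S ↔ ψ w ∈ T :=
    Submodule.mem_map_equiv (e := φ.toLinearEquiv.restrictScalars 𝒪) T
  refine ⟨f.compl₁₂ ψ ψ, S, ⟨nondegenerate_of_isAlt_of_separatingLeft (fun w => hf.isAlt _)
    fun w hw => ?_, fun w => hf.isAlt _, fun g w w' => ?_⟩, isLattice_map _ T, fun g w hw => ?_, ?_⟩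
  · exact ψ.map_eq_zero_iff.1 (hf.nondegenerate.1 _ (ψ.surjective.forall.2 hw))
  · simp only [LinearMap.compl₁₂_apply, LinearEquiv.coe_coe, hψ, hf.invariant]
  · rw [mem_S, hψ]
    exact hTρ g _ (mem_S.1 hw)
  · ext w
    rw [mem_S, ← hTf]
    simp only [LinearMap.BilinForm.mem_dualSubmodule, mem_S, ψ.surjective.forall]
    rfl

theorem HasSelfDualLattice.of_isCompl {U U' : Submodule K V} (hc : IsCompl U U')
    (hU : IsStable ρ U) (hU' : IsStable ρ U')
    (h : HasSelfDualLattice 𝒪 (ρ.subrepresentation U hU))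
    (h' : HasSelfDualLattice 𝒪 (ρ.subrepresentation U' hU')) : HasSelfDualLattice 𝒪 ρ :=
  (h.prod h').of_equiv <| .mk (Submodule.prodEquivOfIsCompl U U' hc) fun g => by
    ext <;> simp <;> rfl

end Splitting

section OrthogonalDecomposition

variable {K V G : Type*} [Field K] [AddCommGroup V] [Module K V] [Group G]
  {ρ : Representation K G V} {f : LinearMap.BilinForm K V} {W : Submodule K V}

namespace IsSymplecticForm

theorem subrepresentation (hf : IsSymplecticForm ρ f) (hW : IsStable ρ W)
    (hnondeg : (f.restrict W).Nondegenerate) :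
    IsSymplecticForm (ρ.subrepresentation W hW) (f.restrict W) :=
  ⟨hnondeg, fun x => hf.isAlt x.1, fun g x y => hf.invariant g x.1 y.1⟩

theorem isStable_orthogonal (hf : IsSymplecticForm ρ f) (hW : IsStable ρ W) :
    IsStable ρ (f.orthogonal W) := by
  intro g x hx w hw
  have h : f (ρ g⁻¹ w) x = 0 := hx _ (hW g⁻¹ w hw)
  rwa [hf.apply_left, inv_inv] at h

theorem restrict_orthogonal_nondegenerate [FiniteDimensional K V] (hf : IsSymplecticForm ρ f)
    (hW : (f.restrict W).Nondegenerate) : (f.restrict (f.orthogonal W)).Nondegenerate := by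
  have hrefl := hf.isAlt.isRefl
  refine LinearMap.BilinForm.nondegenerate_restrict_of_disjoint_orthogonal f hrefl ?_
  rw [LinearMap.BilinForm.orthogonal_orthogonal hf.nondegenerate hrefl]
  exact (LinearMap.BilinForm.isCompl_orthogonal_of_restrict_nondegenerate hrefl hW).symm.disjoint

theorem hasSelfDualLattice [FiniteDimensional K V] {𝒪 : Type*} [CommRing 𝒪] [IsDomain 𝒪]
    [IsDiscreteValuationRing 𝒪] [Algebra 𝒪 K] [IsFractionRing 𝒪 K] [CharZero K] [Finite G]
    [Module 𝒪 V] [IsScalarTower 𝒪 K V] (hf : IsSymplecticForm ρ f)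
    {ℓ e : ℕ} (hℓ : ℓ.Prime) [CharP (IsLocalRing.ResidueField 𝒪) ℓ]
    (he : IsDiscreteValuationRing.addVal 𝒪 (ℓ : 𝒪) = (e : ℕ∞))
    (hdim : finrank K V * e < 2 * (ℓ - 1)) {H : Subgroup G} [H.Normal] [Group.IsSolvable H]
    [IsCyclic (G ⧸ H)] (hH : ¬ ℓ ∣ Nat.card H) : HasSelfDualLattice 𝒪 ρ := by
  induction hn : finrank K V using Nat.strong_induction_on generalizing V with
  | _ n ih =>
  subst hn
  by_cases hind : IsSymplecticallyIndecomposable ρ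
  · exact hind.hasSelfDualLattice hf hℓ he hdim hH
  unfold IsSymplecticallyIndecomposable at hind
  push Not at hind
  obtain ⟨f, W, hf, hW, hnondeg, hbot, htop⟩ := hind
  have hcompl := LinearMap.BilinForm.isCompl_orthogonal_of_restrict_nondegenerate
    hf.isAlt.isRefl hnondeg
  have hlt : finrank K W < finrank K V := Submodule.finrank_lt htop
  have hlt' : finrank K (f.orthogonal W) < finrank K V := Submodule.finrank_lt fun h =>
    hbot (disjoint_top.1 (h ▸ hcompl.disjoint))
  exact .of_isCompl hcompl hW (hf.isStable_orthogonal hW)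
    (ih _ hlt (hf.subrepresentation hW hnondeg) (hdim.trans_le' (by gcongr)) rfl)
    (ih _ hlt' (hf.subrepresentation _ (hf.restrict_orthogonal_nondegenerate hnondeg))
      (hdim.trans_le' (by gcongr)) rfl)

end IsSymplecticForm

end OrthogonalDecomposition

section SymplecticBasis

variable {R M : Type*} [CommRing R] [AddCommGroup M] [Module R M] {f : LinearMap.BilinForm R M}

/-- The Gram matrix of the concatenation of `u` and `w` under `f` is `Matrix.J`. Only the pairings
that do not follow from the others when `f` is alternating are recorded. -/
structure IsSymplecticFamily (f : LinearMap.BilinForm R M) {m : ℕ} (u w : Fin m → M) : Prop where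
  left (i j : Fin m) : f (u i) (u j) = 0
  right (i j : Fin m) : f (w i) (w j) = 0
  right_left (i j : Fin m) : f (w i) (u j) = if i = j then 1 else 0

namespace IsSymplecticFamily

variable {m : ℕ} {u w : Fin m → M}

theorem left_right (h : IsSymplecticFamily f u w) (hf : f.IsAlt) (i j : Fin m) :
    f (u i) (w j) = -if i = j then 1 else 0 := by
  rw [← hf.neg_eq (w j) (u i), h.right_left]
  simp only [eq_comm]

theorem linearIndependent (h : IsSymplecticFamily f u w) (hf : f.IsAlt) :
    LinearIndependent R (Sum.elim u w) := by
  refine Fintype.linearIndependent_iff.2 fun c hc => ?_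
  have hpair (z : M) :
      ∑ i, c (Sum.inl i) * f (u i) z + ∑ i, c (Sum.inr i) * f (w i) z = 0 := by
    simpa [Fintype.sum_sum_type] using congrArg (fun t => f t z) hc
  rintro (i | i)
  · simpa [h.left_right hf, h.right] using hpair (w i)
  · simpa [h.left, h.right_left] using hpair (u i)

theorem exists_basis_toMatrix_eq_J (h : IsSymplecticFamily f u w) (hf : f.IsAlt)
    (hspan : Submodule.span R (Set.range u ∪ Set.range w) = ⊤) :
    ∃ b : Basis (Fin m ⊕ Fin m) R M,
      LinearMap.BilinForm.toMatrix b f = Matrix.J (Fin m) R := by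
  refine ⟨.mk (h.linearIndependent hf) (by rw [Set.Sum.elim_range, hspan]), ?_⟩
  ext (i | i) (j | j) <;>
    simp [Matrix.J, h.left, h.right, h.left_right hf, h.right_left, Matrix.one_apply]

theorem cons (h : IsSymplecticFamily f u w) (hf : f.IsAlt) {x y : M} (hyx : f y x = 1)
    (hu : ∀ i, f x (u i) = 0 ∧ f y (u i) = 0) (hw : ∀ i, f x (w i) = 0 ∧ f y (w i) = 0) :
    IsSymplecticFamily f (Fin.cons x u : Fin (m + 1) → M) (Fin.cons y w : Fin (m + 1) → M) where
  left := by
    refine Fin.cases (Fin.cases (hf x) fun j => (hu j).1) fun i => Fin.cases ?_ (h.left i)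
    exact hf.isRefl _ _ (hu i).1
  right := by
    refine Fin.cases (Fin.cases (hf y) fun j => (hw j).2) fun i => Fin.cases ?_ (h.right i)
    exact hf.isRefl _ _ (hw i).2
  right_left := by
    refine Fin.cases (Fin.cases hyx fun j => ?_) fun i => Fin.cases ?_ fun j => ?_
    · simpa [(Fin.succ_ne_zero j).symm] using (hu j).2
    · simpa using hf.isRefl _ _ (hw i).1
    · simpa using h.right_left i j

end IsSymplecticFamily

theorem bijective_restrict_of_isCompl {N P : Submodule R M} (hc : IsCompl N P)
    (horth : ∀ v ∈ N, ∀ w ∈ P, f v w = 0) (horth' : ∀ w ∈ P, ∀ v ∈ N, f w v = 0)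
    (hf : Function.Bijective f) : Function.Bijective (f.restrict N) := by
  refine ⟨(injective_iff_map_eq_zero _).2 fun v hv => Subtype.ext (hf.1 ?_), fun φ => ?_⟩
  · rw [Submodule.coe_zero, map_zero]
    exact LinearMap.ext_on_codisjoint hc.codisjoint (fun z hz => LinearMap.congr_fun hv ⟨z, hz⟩)
      (horth v v.2)
  · obtain ⟨z, hz⟩ := hf.2 (φ ∘ₗ N.projectionOnto P hc)
    obtain ⟨v, w, hv, hw, rfl⟩ := Submodule.codisjoint_iff_exists_add_eq.1 hc.codisjoint z
    refine ⟨⟨v, hv⟩, LinearMap.ext fun t => ?_⟩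
    have ht : f v t + f w t = φ t := by simpa using LinearMap.congr_fun hz t
    rwa [horth' w hw t t.2, add_zero] at ht

theorem isCompl_ker_inf_ker_span_pair (hf : f.IsAlt) {x y : M} (hyx : f y x = 1) :
    IsCompl (LinearMap.ker (f x) ⊓ LinearMap.ker (f y)) (Submodule.span R {x, y}) := by
  have hxy : f x y = -1 := by rw [← hf.neg_eq y x, hyx]
  refine ⟨Submodule.disjoint_def.2 fun z ⟨hxz, hyz⟩ hz => ?_,
    Submodule.codisjoint_iff_exists_add_eq.2 fun z =>
      ⟨z - (f y z • x - f x z • y), f y z • x - f x z • y, ⟨?_, ?_⟩, ?_, sub_add_cancel _ _⟩⟩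
  · obtain ⟨a, b, rfl⟩ := Submodule.mem_span_pair.1 hz
    have hb : b = 0 := by simpa [hf x, hxy] using hxz
    have ha : a = 0 := by simpa [hf y, hyx] using hyz
    rw [ha, hb, zero_smul, zero_smul, add_zero]
  · simp [hf x, hxy]
  · simp [hf y, hyx]
  · exact sub_mem (Submodule.smul_mem _ _ (Submodule.subset_span (by simp)))
      (Submodule.smul_mem _ _ (Submodule.subset_span (by simp)))

variable [IsDomain R] [IsPrincipalIdealRing R]

theorem exists_isSymplecticFamily_span_eq_top [Module.Finite R M] [Module.Free R M] (hf : f.IsAlt)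
    (hbij : Function.Bijective f) : ∃ (m : ℕ) (u w : Fin m → M),
      IsSymplecticFamily f u w ∧ Submodule.span R (Set.range u ∪ Set.range w) = ⊤ := by
  induction hn : finrank R M using Nat.strong_induction_on generalizing M with
  | _ n ih =>
  subst hn
  cases subsingleton_or_nontrivial M
  · exact ⟨0, ![], ![], ⟨fun i => i.elim0, fun i => i.elim0, fun i => i.elim0⟩,
      Subsingleton.elim _ _⟩
  obtain ⟨i⟩ := (Module.Free.chooseBasis R M).index_nonempty
  let x : M := Module.Free.chooseBasis R M i
  obtain ⟨y, hy⟩ := hbij.2 ((Module.Free.chooseBasis R M).coord i)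
  have hyx : f y x = 1 := by simp [hy, x]
  let N : Submodule R M := LinearMap.ker (f x) ⊓ LinearMap.ker (f y)
  let P : Submodule R M := Submodule.span R {x, y}
  have hc : IsCompl N P := isCompl_ker_inf_ker_span_pair hf hyx
  have horth : ∀ w ∈ P, ∀ v ∈ N, f w v = 0 := by
    rintro _ hw v ⟨hxv, hyv⟩
    obtain ⟨a, b, rfl⟩ := Submodule.mem_span_pair.1 hw
    simp [LinearMap.mem_ker.1 hxv, LinearMap.mem_ker.1 hyv]
  have hlt : finrank R N < finrank R M := by
    have : Nontrivial P := ⟨⟨x, Submodule.subset_span (by simp)⟩, 0, fun h =>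
      Module.Basis.ne_zero _ i (congrArg Subtype.val h)⟩
    rw [← (Submodule.prodEquivOfIsCompl N P hc).finrank_eq, Module.finrank_prod]
    exact Nat.lt_add_of_pos_right Module.finrank_pos
  obtain ⟨m, u, w, huw, hspan⟩ := ih _ hlt (f := f.restrict N) (fun z => hf z)
    (bijective_restrict_of_isCompl hc (fun v hv w hw => hf.isRefl _ _ (horth w hw v hv))
      horth hbij) rfl
  have huw' : IsSymplecticFamily f (N.subtype ∘ u) (N.subtype ∘ w) :=
    ⟨huw.left, huw.right, huw.right_left⟩
  refine ⟨m + 1, Fin.cons x (N.subtype ∘ u), Fin.cons y (N.subtype ∘ w),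
    huw'.cons hf hyx (fun i => (u i).2) fun i => (w i).2, ?_⟩
  have hN : Submodule.span R (N.subtype '' Set.range u ∪ N.subtype '' Set.range w) = N := by
    rw [← Set.image_union, Submodule.span_image, hspan, Submodule.map_subtype_top]
  rw [Fin.range_cons, Fin.range_cons, Set.range_comp, Set.range_comp, Set.insert_union,
    Set.union_insert, Submodule.span_insert, Submodule.span_insert, hN, ← sup_assoc,
    ← Submodule.span_insert, sup_comm, hc.sup_eq_top]

theorem exists_basis_toMatrix_eq_J [Module.Finite R M] [Module.Free R M] (hf : f.IsAlt)
    (hbij : Function.Bijective f) {d : ℕ} (hd : finrank R M = 2 * d) :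
    ∃ b : Basis (Fin d ⊕ Fin d) R M,
      LinearMap.BilinForm.toMatrix b f = Matrix.J (Fin d) R := by
  obtain ⟨m, u, w, huw, hspan⟩ := exists_isSymplecticFamily_span_eq_top hf hbij
  obtain ⟨b, hb⟩ := huw.exists_basis_toMatrix_eq_J hf hspan
  have hm : finrank R M = m + m := by simpa using Module.finrank_eq_card_basis b
  obtain rfl : m = d := by omega
  exact ⟨b, hb⟩

end SymplecticBasis

section IntegralForm

variable {𝒪 K V G : Type*} [CommRing 𝒪] [Field K] [Algebra 𝒪 K] [IsFractionRing 𝒪 K]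
  [AddCommGroup V] [Module K V] [Module 𝒪 V] [IsScalarTower 𝒪 K V] [Group G]
  {ρ : Representation K G V} {T : Submodule 𝒪 V}

theorem extendOfIsLattice_repr [Submodule.IsLattice K T] {ι : Type*} (b : Basis ι 𝒪 T) (t : T)
    (i : ι) : (b.extendOfIsLattice K).repr (t : V) i = algebraMap 𝒪 K (b.repr t i) := by
  classical
  suffices h : ((b.extendOfIsLattice K).coord i).restrictScalars 𝒪 ∘ₗ T.subtype =
      Algebra.linearMap 𝒪 K ∘ₗ b.coord i from LinearMap.congr_fun h t
  refine b.ext fun j => ?_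
  change (b.extendOfIsLattice K).repr (b j : V) i = algebraMap 𝒪 K (b.repr (b j) i)
  rw [← b.extendOfIsLattice_apply K, Basis.repr_self, Basis.repr_self, Finsupp.single_apply,
    Finsupp.single_apply, apply_ite (algebraMap 𝒪 K), map_one, map_zero]

theorem toMatrix_extendOfIsLattice [Submodule.IsLattice K T] {ι : Type*} [Fintype ι]
    [DecidableEq ι] (b : Basis ι 𝒪 T) {r : T →ₗ[𝒪] T} {φ : V →ₗ[K] V} (h : ∀ t : T, φ t = r t) :
    LinearMap.toMatrix (b.extendOfIsLattice K) (b.extendOfIsLattice K) φ =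
      (LinearMap.toMatrix b b r).map (algebraMap 𝒪 K) := by
  ext i j
  rw [Matrix.map_apply, LinearMap.toMatrix_apply, LinearMap.toMatrix_apply,
    Basis.extendOfIsLattice_apply, h, extendOfIsLattice_repr]

theorem exists_conj_mem_symplecticGroup [Submodule.IsLattice K T] {d : ℕ}
    (b : Basis (Fin d ⊕ Fin d) K V) (c : Basis (Fin d ⊕ Fin d) 𝒪 T) {f : LinearMap.BilinForm 𝒪 T}
    (hc : LinearMap.BilinForm.toMatrix c f = Matrix.J (Fin d) 𝒪) (hT : IsStable ρ T)
    (hf : ∀ g (x y : T), f ⟨ρ g x, hT g x x.2⟩ ⟨ρ g y, hT g y y.2⟩ = f x y) :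
    ∃ P : Matrix.GeneralLinearGroup (Fin d ⊕ Fin d) K, ∀ g,
      ∃ A ∈ Matrix.symplecticGroup (Fin d) 𝒪,
        P.1 * LinearMap.toMatrix b b (ρ g) * P⁻¹.1 = A.map (algebraMap 𝒪 K) := by
  let c' := c.extendOfIsLattice K
  refine ⟨⟨c'.toMatrix b, b.toMatrix c', c'.toMatrix_mul_toMatrix_flip b,
    b.toMatrix_mul_toMatrix_flip c'⟩, fun g => ?_⟩
  let r : T →ₗ[𝒪] T := ((ρ g).restrictScalars 𝒪).restrict (hT g)
  refine ⟨LinearMap.toMatrix c c r, ?_, ?_⟩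
  · have hr : f.comp r r = f := LinearMap.ext₂ (hf g)
    rw [SymplecticGroup.mem_iff', ← hc, ← LinearMap.BilinForm.toMatrix_comp, hr]
  · rw [Units.inv_mk, basis_toMatrix_mul_linearMap_toMatrix_mul_basis_toMatrix]
    exact toMatrix_extendOfIsLattice c fun _ => rfl

variable [IsDomain 𝒪] [IsPrincipalIdealRing 𝒪]

theorem exists_isPerfPair_of_dualSubmodule_eq [FiniteDimensional K V] [Submodule.IsLattice K T]
    {f : LinearMap.BilinForm K V} (hf : f.Nondegenerate) (hT : f.dualSubmodule T = T) :
    ∃ f' : LinearMap.BilinForm 𝒪 T, f'.IsPerfPair ∧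
      ∀ x y : T, algebraMap 𝒪 K (f' x y) = f x y := by
  have : IsTorsionFree 𝒪 K := inferInstance
  have : Module.Free 𝒪 T := Submodule.IsLattice.free K T
  have : Module.Finite 𝒪 T := .of_fg (Submodule.IsLattice.fg (A := K))
  let f' : LinearMap.BilinForm 𝒪 T := f.dualSubmoduleToDual T ∘ₗ Submodule.inclusion hT.ge
  have hf' (x y : T) : algebraMap 𝒪 K (f' x y) = f x y :=
    f.dualSubmoduleParing_spec (Submodule.inclusion hT.ge x) y
  refine ⟨f', .of_bijective _ ⟨?_, fun φ => ?_⟩, hf'⟩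
  · exact (f.dualSubmoduleToDual_injective hf T Submodule.IsLattice.span_eq_top).comp
      (Submodule.inclusion_injective _)
  · obtain ⟨φ', hφ'⟩ := exists_linearMap_extending (K := K) (Algebra.linearMap 𝒪 K ∘ₗ φ)
    obtain ⟨v, rfl⟩ := (f.toDual hf).surjective φ'
    have hvT : v ∈ T := hT.le fun t ht => Submodule.mem_one.2 ⟨_, (hφ' ⟨t, ht⟩).symm⟩
    exact ⟨⟨v, hvT⟩, LinearMap.ext fun t =>
      IsFractionRing.injective 𝒪 K ((hf' _ t).trans (hφ' t))⟩

theorem HasSelfDualLattice.exists_isPerfPair [FiniteDimensional K V]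
    (h : HasSelfDualLattice 𝒪 ρ) :
    ∃ (T : Submodule 𝒪 V) (hT : IsStable ρ T), Submodule.IsLattice K T ∧
      ∃ f : LinearMap.BilinForm 𝒪 T, f.IsPerfPair ∧ f.IsAlt ∧
        ∀ g (x y : T), f ⟨ρ g x, hT g x x.2⟩ ⟨ρ g y, hT g y y.2⟩ = f x y := by
  obtain ⟨F, T, hF, hT, hTρ, hTF⟩ := h
  have hinj := IsFractionRing.injective 𝒪 K
  obtain ⟨f, hperf, hfF⟩ := exists_isPerfPair_of_dualSubmodule_eq hF.nondegenerate hTF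
  refine ⟨T, hTρ, hT, f, hperf, fun x => hinj ?_, fun g x y => hinj ?_⟩
  · rw [hfF, hF.isAlt, map_zero]
  · rw [hfF, hfF, hF.invariant]

theorem exists_basis_toMatrix_eq_J_of_isLattice [Submodule.IsLattice K T]
    {f : LinearMap.BilinForm 𝒪 T} (hperf : f.IsPerfPair) (halt : f.IsAlt) {d : ℕ}
    (hd : finrank K V = 2 * d) :
    ∃ c : Basis (Fin d ⊕ Fin d) 𝒪 T,
      LinearMap.BilinForm.toMatrix c f = Matrix.J (Fin d) 𝒪 := by
  have : Module.Free 𝒪 T := Submodule.IsLattice.free K T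
  have : Module.Finite 𝒪 T := .of_fg (Submodule.IsLattice.fg (A := K))
  have hrank : finrank 𝒪 T = 2 * d := by
    rw [← hd, finrank, finrank, Submodule.IsLattice.rank' K T]
  exact exists_basis_toMatrix_eq_J halt hperf.bijective_left hrank

end IntegralForm

theorem not_dvd_card_of_isPGroup {p ℓ : ℕ} (hp : p.Prime) (hℓ : ℓ.Prime) (hℓp : ℓ ≠ p)
    {H : Type*} [Group H] [Finite H] (hH : IsPGroup p H) : ¬ ℓ ∣ Nat.card H := by
  have : Fact p.Prime := ⟨hp⟩
  obtain ⟨n, hn⟩ := IsPGroup.iff_card.1 hH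
  exact fun h => hℓp ((Nat.prime_dvd_prime_iff_eq hℓ hp).1 (hℓ.dvd_of_dvd_pow (hn ▸ h)))

theorem IsOfInertiaType.exists_isSolvable {p ℓ : ℕ} {G : Type*} [Group G] (hG : IsOfInertiaType p G)
    (hp : p.Prime) (hℓ : ℓ.Prime) (hℓp : ℓ ≠ p) :
    Finite G ∧ ∃ (H : Subgroup G) (_ : H.Normal),
      Group.IsSolvable H ∧ IsCyclic (G ⧸ H) ∧ ¬ ℓ ∣ Nat.card H := by
  obtain ⟨_, H, _, hH, _, -⟩ := hG
  have : Fact p.Prime := ⟨hp⟩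
  have : Group.IsNilpotent H := hH.isNilpotent
  exact ⟨‹_›, H, ‹_›, inferInstance, ‹_›, not_dvd_card_of_isPGroup hp hℓ hℓp hH⟩

theorem theorem4p3_general {G : Type*} [Group G] [Finite G] (H : Subgroup G) [H.Normal]
    [Group.IsSolvable H] [IsCyclic (G ⧸ H)] {ℓ : ℕ} (hℓ : ℓ.Prime) (hH : ¬ ℓ ∣ Nat.card H)
    {𝒪 K : Type*} [CommRing 𝒪] [IsDomain 𝒪] [IsDiscreteValuationRing 𝒪]
    [Field K] [Algebra 𝒪 K] [IsFractionRing 𝒪 K]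
    [CharZero K] [CharP (IsLocalRing.ResidueField 𝒪) ℓ]
    (e : ℕ) (he : IsDiscreteValuationRing.addVal 𝒪 (ℓ : 𝒪) = (e : ℕ∞))
    {V : Type*} [AddCommGroup V] [Module K V] [Module 𝒪 V] [IsScalarTower 𝒪 K V]
    [FiniteDimensional K V] (d : ℕ) (hd : Module.finrank K V = 2 * d)
    (ρ : Representation K G V) (hρ : ρ.IsSymplectic) (hde : d * e + 1 < ℓ) :
    (∃ (T : Submodule 𝒪 V) (hT : ∀ (g : G), ∀ x ∈ T, ρ g x ∈ T),
      Submodule.IsLattice K T ∧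
      ∃ f' : LinearMap.BilinForm 𝒪 T, f'.IsPerfPair ∧ f'.IsAlt ∧
        ∀ (g : G) (x y : T),
          f' ⟨ρ g x, hT g x x.2⟩ ⟨ρ g y, hT g y y.2⟩ = f' x y) ∧
    (∀ b : Module.Basis (Fin d ⊕ Fin d) K V,
      ∃ P : Matrix.GeneralLinearGroup (Fin d ⊕ Fin d) K, ∀ g : G,
        ∃ A ∈ Matrix.symplecticGroup (Fin d) 𝒪,
          P.1 * LinearMap.toMatrix b b (ρ g) * P⁻¹.1 = A.map (algebraMap 𝒪 K)) := by
  obtain ⟨F, hnondeg, halt, hinv⟩ := hρ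
  have hdim : finrank K V * e < 2 * (ℓ - 1) := by
    rw [hd, mul_assoc]
    lia
  have hself : HasSelfDualLattice 𝒪 ρ :=
    IsSymplecticForm.hasSelfDualLattice ⟨hnondeg, halt, hinv⟩ hℓ he hdim hH
  obtain ⟨T, hT, hlat, f, hperf, halt, hinv⟩ := hself.exists_isPerfPair
  obtain ⟨c, hc⟩ := exists_basis_toMatrix_eq_J_of_isLattice hperf halt hd
  exact ⟨⟨T, hT, hlat, f, hperf, halt, hinv⟩,
    fun b => exists_conj_mem_symplecticGroup b c hc hT hinv⟩

theorem theorem4p3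
    (p ℓ : ℕ) (hp : p.Prime) (hℓ : ℓ.Prime) (hℓp : ℓ ≠ p)
    {G : Type*} [Group G] (hG : IsOfInertiaType p G)
    -- `K` is a complete discrete valuation field with valuation ring `𝒪`
    {𝒪 K : Type*} [CommRing 𝒪] [IsDomain 𝒪] [IsDiscreteValuationRing 𝒪]
    [IsAdicComplete (IsLocalRing.maximalIdeal 𝒪) 𝒪]
    [Field K] [Algebra 𝒪 K] [IsFractionRing 𝒪 K]
    [CharZero K] [CharP (IsLocalRing.ResidueField 𝒪) ℓ]
    (e : ℕ) (he : IsDiscreteValuationRing.addVal 𝒪 (ℓ : 𝒪) = (e : ℕ∞))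
    {V : Type*} [AddCommGroup V] [Module K V] [Module 𝒪 V] [IsScalarTower 𝒪 K V]
    [FiniteDimensional K V] (d : ℕ) (hd : Module.finrank K V = 2 * d)
    (ρ : Representation K G V) (hρ : ρ.IsSymplectic) (hde : d * e + 1 < ℓ) :
    (∃ (T : Submodule 𝒪 V) (hT : ∀ (g : G), ∀ x ∈ T, ρ g x ∈ T),
      Submodule.IsLattice K T ∧
      ∃ f' : LinearMap.BilinForm 𝒪 T, f'.IsPerfPair ∧ f'.IsAlt ∧
        ∀ (g : G) (x y : T),
          f' ⟨ρ g x, hT g x x.2⟩ ⟨ρ g y, hT g y y.2⟩ = f' x y) ∧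
    (∀ b : Module.Basis (Fin d ⊕ Fin d) K V,
      ∃ P : Matrix.GeneralLinearGroup (Fin d ⊕ Fin d) K, ∀ g : G,
        ∃ A ∈ Matrix.symplecticGroup (Fin d) 𝒪,
          P.1 * LinearMap.toMatrix b b (ρ g) * P⁻¹.1 = A.map (algebraMap 𝒪 K)) := by
  obtain ⟨_, H, _, _, _, hH⟩ := hG.exists_isSolvable hp hℓ hℓp
  exact theorem4p3_general H hℓ hH e he d hd ρ hρ hde
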